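/- **Setting.** Let $m,n,N\ge 1$ and $K$ be integers, $\mathcal X$ a measurable space, and $f_W:\mathcal X\to\mathbb R^K$ ($W\in\mathbb R^{m\times n}$) a network, measurable in the input for every $W$ and, for every input, differentiable in $W$ at $W_0$. Write $G^{(j)}(x)=\nabla_W f^{(j)}_{W}(x)|_{W=W_0}\in\mathbb R^{m\times n}$ and $\langle G(x),\Delta\rangle=(\mathrm{tr}(G^{(j)}(x)^\top\Delta))_{j\le K}$. Let $\ell(\hat y,y)=-\sum_j y^{(j)}\log\mathrm{softmax}(\hat y)^{(j)}$ be the cross-entropy loss. Let $(X,Y)\sim P$ with $Y$ almost surely a probability vector in $\mathbb R^K$, $\mathbb E[\ell(f_{W_0}(X),Y)]<\infty$, and $\max_j\|G^{(j)}(X)\|_{\mathrm{op}}\le R$ almost surely, and let $S=(X_i,Y_i)_{i\le N}$ be i.i.d. from $P$. For $B>0$ and $r\ge1$ let $$\mathcal H_r=\{x\mapsto f_{W_0}(x)+\langle G(x),uv^\top\rangle:\ u\in\mathbb R^{m\times r},\ v\in\mathbb R^{n\times r},\ \|u\|_F\|v\|_F\le B\},$$ $$\mathrm{bias}(r)=\inf_{f\in\mathcal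 H_r}\mathbb E[\ell(f(X),Y)],\qquad \mathrm{var}(r)=B\sqrt{\frac{r(m+n)-r^2}{N}} .$$ Let $\hat L_S(u,v)=\frac1N\sum_i\ell(f_{W_0}(X_i)+\langle G(X_i),uv^\top\rangle,Y_i)$. A *trained rank-$r$ model* on $S$ is a predictor $f_r=f_{W_0}+\langle G,uv^\top\rangle$ with $\|u\|_F\|v\|_F\le B$ such that either $(u,v)$ minimizes $\hat L_S$ among all pairs obeying this constraint, or, for some initialization $(u_0,v_0)$ such that $\hat L_S$ satisfies the Polyak–Łojasiewicz inequality $\tfrac12\|\nabla\hat L_S\|^2\ge\mu(\hat L_S-\inf\hat L_S)$, for some $\mu>0$, on the level set $\{\hat L_S\le\hat L_S(u_0,v_0)\}$, the pair $(u,v)$ is a second-order stationary point of $\hat L_S$ in that level set. Ranks are restricted to $1\le r\le (m+n)/2$ unless stated otherwise. **Proposition.** There is an absolute constant $C>0$ such that in every such setting the following hold. 1. *Rademacher complexity.* For all points $x_1,\dots,x_N$ and every output coordinate $j$, the empirical Rademacher complexity of $\{f^{(j)}:f\in\mathcal H_r\}$ on these points is at most $\max_i\|G^{(j)}(x_i)\|_{\mathrm{op}}\cdot\mathrm{var}(r)$.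 2. *Test risk.* Let $c\ge CR$. For any choice of a trained rank-$r$ model $f_r$ depending on the sample (with measurable test risk), the test risk is integrable and $$\mathbb E_S\,\mathbb E_{(X,Y)}[\ell(f_r(X),Y)]\le \mathrm{bias}(r)+c\,B\sqrt{\tfrac{r(m+n)-r^2}{N}} .$$ Moreover, for every $\delta\in(0,1)$, with probability at least $1-\delta$ over $S$, every trained rank-$r$ model satisfies $$\mathbb E_{(X,Y)}[\ell(f_r(X),Y)]\le \mathrm{bias}(r)+c\,B\sqrt{\tfrac{r(m+n)-r^2}{N}}+c\,B\sqrt{\tfrac{\log(2/\delta)}{N}} .$$ 3. *Monotonicity.* $\mathrm{var}(r)$ is strictly increasing for $1\le r\le(m+n)/2$, and $\mathrm{bias}(r)$ is non-increasing over all $r\ge1$. 4. *Optimal rank.* Let $c>0$ and let $r^*$ denote any minimizer of $\mathrm{bias}(r)+c\,\mathrm{var}(r)$ over $1\le r\le (m+n)/2$. Let $A\in\mathbb R$ with $8A\le c$. If $\mathrm{bias}(1)-\mathrm{bias}(r)\le A\,B\sqrt{(m+n)/N}$ for all $1<r\le(m+n)/2$, then $r^*=1$ is the unique minimizer. Conversely,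 for any minimizer $r^*\ne1$ bias reduction dominates: $\mathrm{bias}(1)-\mathrm{bias}(r^*)>A\,B\sqrt{(m+n)/N}$ and $\mathrm{bias}(1)-\mathrm{bias}(r^*)\ge c\,(\mathrm{var}(r^*)-\mathrm{var}(1))$. In particular, for every $O$-constant $A\ge0$ and $R>0$, the choice $c=\max(CR,8A)$ gives a risk bound whose optimal rank is $r^*=1$ whenever the bias gap $\mathrm{bias}(1)-\mathrm{bias}(r)$ is at most $A\,B\sqrt{(m+n)/N}$. -/

import Mathlib

open MeasureTheory

universe u

noncomputable section

/-- Frobenius norm of a real matrix. -/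
def frobNorm {a b : ℕ} (A : Matrix (Fin a) (Fin b) ℝ) : ℝ :=
  Real.sqrt (∑ i, ∑ j, A i j ^ 2)

/-- Frobenius inner product `tr (Aᵀ D)`. -/
def frobInner {a b : ℕ} (A D : Matrix (Fin a) (Fin b) ℝ) : ℝ :=
  (A.transpose * D).trace

/-- Spectral norm: the operator norm between Euclidean spaces. -/
def specNorm {a b : ℕ} (A : Matrix (Fin a) (Fin b) ℝ) : ℝ :=
  ‖LinearMap.toContinuousLinearMap (Matrix.toEuclideanLin A)‖

/-- Softmax of a vector of logits. -/
def softmax {K : ℕ} (a : Fin K → ℝ) (j : Fin K) : ℝ :=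
  Real.exp (a j) / ∑ k, Real.exp (a k)

/-- Cross-entropy loss of the logits `a` against the label `y`. -/
def ceLoss {K : ℕ} (a y : Fin K → ℝ) : ℝ :=
  -∑ j, y j * Real.log (softmax a j)

section Model

variable {𝒳 : Type u} {K m n : ℕ}

/-- The gradient with respect to the weight matrix, at `W₀`, of the `j`-th output of the
network at the input `x`: the matrix of its partial derivatives. -/
def jac (net : Matrix (Fin m) (Fin n) ℝ → 𝒳 → Fin K → ℝ) (W₀ : Matrix (Fin m) (Fin n) ℝ)
    (x : 𝒳) (j : Fin K) : Matrix (Fin m) (Fin n) ℝ :=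
  Matrix.of fun a b => deriv (fun t : ℝ => net (W₀ + t • Matrix.single a b 1) x j) 0

/-- The network linearized at `W₀` (NTK regime), with weight perturbation `D`. -/
def linModel (net : Matrix (Fin m) (Fin n) ℝ → 𝒳 → Fin K → ℝ)
    (W₀ D : Matrix (Fin m) (Fin n) ℝ) : 𝒳 → Fin K → ℝ :=
  fun x j => net W₀ x j + frobInner (jac net W₀ x j) D

/-- The linearized LoRA model with factors `u`, `v`, that is, with perturbation `u vᵀ`. -/
def loraModel (net : Matrix (Fin m) (Fin n) ℝ → 𝒳 → Fin K → ℝ) (W₀ : Matrix (Fin m) (Fin n) ℝ)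
    {r : ℕ} (u : Matrix (Fin m) (Fin r) ℝ) (v : Matrix (Fin n) (Fin r) ℝ) : 𝒳 → Fin K → ℝ :=
  linModel net W₀ (u * v.transpose)

/-- The rank-`r` LoRA hypothesis class with `‖u‖_F ‖v‖_F ≤ B`. -/
def hypClass (net : Matrix (Fin m) (Fin n) ℝ → 𝒳 → Fin K → ℝ) (W₀ : Matrix (Fin m) (Fin n) ℝ)
    (B : ℝ) (r : ℕ) : Set (𝒳 → Fin K → ℝ) :=
  {f | ∃ (u : Matrix (Fin m) (Fin r) ℝ) (v : Matrix (Fin n) (Fin r) ℝ),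
    frobNorm u * frobNorm v ≤ B ∧ f = loraModel net W₀ u v}

/-- Test risk (expected cross-entropy) of a predictor under the law `P` of `(X, Y)`. -/
def risk [MeasurableSpace 𝒳] (P : Measure (𝒳 × (Fin K → ℝ))) (f : 𝒳 → Fin K → ℝ) : ℝ :=
  ∫ z, ceLoss (f z.1) z.2 ∂P

/-- The bias term: the best test risk in the rank-`r` class. -/
def bias [MeasurableSpace 𝒳] (P : Measure (𝒳 × (Fin K → ℝ)))
    (net : Matrix (Fin m) (Fin n) ℝ → 𝒳 → Fin K → ℝ) (W₀ : Matrix (Fin m) (Fin n) ℝ)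
    (B : ℝ) (r : ℕ) : ℝ :=
  sInf (risk P '' hypClass net W₀ B r)

/-- The variance term `B √((r(m+n) - r²)/N)`. -/
def varTerm (m n N : ℕ) (B : ℝ) (r : ℕ) : ℝ :=
  B * Real.sqrt (((r : ℝ) * ((m : ℝ) + n) - (r : ℝ) ^ 2) / N)

/-- The bias-variance criterion, with constant `c` in front of the variance term. -/
def criterion [MeasurableSpace 𝒳] (P : Measure (𝒳 × (Fin K → ℝ)))
    (net : Matrix (Fin m) (Fin n) ℝ → 𝒳 → Fin K → ℝ) (W₀ : Matrix (Fin m) (Fin n) ℝ)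
    (N : ℕ) (B c : ℝ) (r : ℕ) : ℝ :=
  bias P net W₀ B r + c * varTerm m n N B r

/-- `r` minimizes the bias-variance criterion over the ranks `1 ≤ s ≤ (m+n)/2`. -/
def IsOptimalRank [MeasurableSpace 𝒳] (P : Measure (𝒳 × (Fin K → ℝ)))
    (net : Matrix (Fin m) (Fin n) ℝ → 𝒳 → Fin K → ℝ) (W₀ : Matrix (Fin m) (Fin n) ℝ)
    (N : ℕ) (B c : ℝ) (r : ℕ) : Prop :=
  1 ≤ r ∧ 2 * r ≤ m + n ∧
    ∀ s : ℕ, 1 ≤ s → 2 * s ≤ m + n → criterion P net W₀ N B c r ≤ criterion P net W₀ N B c s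

/-- Empirical Rademacher complexity of a class of real functions on the points `x`;
the expectation over i.i.d. uniform signs is the average over all sign vectors. -/
def empRademacher {N : ℕ} (F : Set (𝒳 → ℝ)) (x : Fin N → 𝒳) : ℝ :=
  (∑ ε : Fin N → ℤˣ,
    sSup ((fun f : 𝒳 → ℝ => (1 / (N : ℝ)) * ∑ i, ((ε i : ℤ) : ℝ) * f (x i)) '' F)) / 2 ^ N

/-- Empirical cross-entropy risk of the LoRA factors `u`, `v` on the sample `S`. -/
def empRisk (net : Matrix (Fin m) (Fin n) ℝ → 𝒳 → Fin K → ℝ) (W₀ : Matrix (Fin m) (Fin n) ℝ)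
    {N r : ℕ} (S : Fin N → 𝒳 × (Fin K → ℝ))
    (u : Matrix (Fin m) (Fin r) ℝ) (v : Matrix (Fin n) (Fin r) ℝ) : ℝ :=
  (1 / (N : ℝ)) * ∑ i, ceLoss (loraModel net W₀ u v (S i).1) (S i).2

end Model

section Landscape

variable {m n r : ℕ}

/-- Squared Euclidean norm of the gradient, in all entries of both factors. -/
def gradSq (L : Matrix (Fin m) (Fin r) ℝ → Matrix (Fin n) (Fin r) ℝ → ℝ)
    (u : Matrix (Fin m) (Fin r) ℝ) (v : Matrix (Fin n) (Fin r) ℝ) : ℝ :=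
  (∑ a, ∑ k, (deriv (fun t : ℝ => L (u + t • Matrix.single a k 1) v) 0) ^ 2) +
    ∑ b, ∑ k, (deriv (fun t : ℝ => L u (v + t • Matrix.single b k 1)) 0) ^ 2

/-- Second-order stationary point: the gradient vanishes, the Hessian is positive semidefinite. -/
def IsSOSP (L : Matrix (Fin m) (Fin r) ℝ → Matrix (Fin n) (Fin r) ℝ → ℝ)
    (u : Matrix (Fin m) (Fin r) ℝ) (v : Matrix (Fin n) (Fin r) ℝ) : Prop :=
  ∀ (a : Matrix (Fin m) (Fin r) ℝ) (b : Matrix (Fin n) (Fin r) ℝ),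
    deriv (fun t : ℝ => L (u + t • a) (v + t • b)) 0 = 0 ∧
      0 ≤ iteratedDeriv 2 (fun t : ℝ => L (u + t • a) (v + t • b)) 0

/-- Polyak-Łojasiewicz inequality on the level set of the initialization `(u₀, v₀)`. -/
def PolyakLojasiewicz (L : Matrix (Fin m) (Fin r) ℝ → Matrix (Fin n) (Fin r) ℝ → ℝ)
    (u₀ : Matrix (Fin m) (Fin r) ℝ) (v₀ : Matrix (Fin n) (Fin r) ℝ) : Prop :=
  ∃ μ : ℝ, 0 < μ ∧ ∀ (u : Matrix (Fin m) (Fin r) ℝ) (v : Matrix (Fin n) (Fin r) ℝ),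
    L u v ≤ L u₀ v₀ →
      μ * (L u v - ⨅ p : Matrix (Fin m) (Fin r) ℝ × Matrix (Fin n) (Fin r) ℝ, L p.1 p.2)
        ≤ 1 / 2 * gradSq L u v

/-- `(u, v)` is a trained pair of factors for the loss `L` and the norm budget `B`: it obeys
`‖u‖_F ‖v‖_F ≤ B`, and either it minimizes `L` among all such pairs, or it is a second-order
stationary point of `L` in the level set of some initialization on which `L` satisfies the
Polyak-Łojasiewicz inequality. -/
def IsTrained (L : Matrix (Fin m) (Fin r) ℝ → Matrix (Fin n) (Fin r) ℝ → ℝ) (B : ℝ)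
    (u : Matrix (Fin m) (Fin r) ℝ) (v : Matrix (Fin n) (Fin r) ℝ) : Prop :=
  frobNorm u * frobNorm v ≤ B ∧
    ((∀ (u' : Matrix (Fin m) (Fin r) ℝ) (v' : Matrix (Fin n) (Fin r) ℝ),
        frobNorm u' * frobNorm v' ≤ B → L u v ≤ L u' v') ∨
      ∃ (u₀ : Matrix (Fin m) (Fin r) ℝ) (v₀ : Matrix (Fin n) (Fin r) ℝ),
        PolyakLojasiewicz L u₀ v₀ ∧ L u v ≤ L u₀ v₀ ∧ IsSOSP L u v)

end Landscape

end

/-! The risk bound does not go through the Rademacher bound. It is a uniform deviation bound over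
factor pairs, proved by chaining in their `r(m+n)` parameters. The product `u vᵀ` is unchanged when
the factors are rebalanced, so every admissible pair becomes `√B θ` with `θ` in a unit ball
(`exists_balanced_factors`). Cross-entropy is `2`-Lipschitz for the sup norm of the logits, whatever
`K` is, and `⟨G, u vᵀ⟩` is bilinear and controlled by the spectral norm. Hence `lossGap`, the loss
minus the pretrained loss, is Lipschitz in `θ` with constant of order `R B`; the subtraction makes
it bounded even though the loss itself is only integrable. Hoeffding along dyadic chains
(`measure_pi_exists_empDev_gt_le`) then controls all its deviations at once, at scale `R B √((r(m+n)
+ log(2/δ))/N)`. A trained pair minimizes the empirical risk within the budget: at a stationary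
point the Polyak–Łojasiewicz inequality forces the value down to the infimum
(`IsTrained.le_of_budget`). Comparing with any competitor costs two deviations, and `r(m+n) ≤
2(r(m+n) - r²)` in the admissible range converts the dimension into the variance term. Integrating
the sub-Gaussian tail gives the bound in expectation. The Rademacher bound is Cauchy–Schwarz in
Frobenius norm plus a second-moment computation over signs. Bias monotonicity is padding by zero
columns. The optimal-rank claims rest on `varTerm_gap`: leaving rank one costs more than `B
√((m+n)/N) / 8` in variance, hence the condition `8A ≤ c`. -/

/-! ### Nets, Hoeffding's inequality, chaining and tail integration. -/

section Chaining

open ProbabilityTheory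

/-- The ball of radius `2` of a `d`-dimensional normed space has a `1`-net with `5 ^ d` points. -/
lemma exists_net_closedBall (E : Type*) [NormedAddCommGroup E] [NormedSpace ℝ E]
    [FiniteDimensional ℝ E] :
    ∃ F : Finset E, F.card ≤ 5 ^ Module.finrank ℝ E ∧ (∀ f ∈ F, ‖f‖ ≤ 2) ∧
      ∀ x : E, ‖x‖ ≤ 2 → ∃ f ∈ F, ‖x - f‖ ≤ 1 := by
  classical
  let p : ℕ → Prop := fun k => ∃ s : Finset E, s.card = k ∧ (∀ c ∈ s, ‖c‖ ≤ 2) ∧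
    ∀ c ∈ s, ∀ d ∈ s, c ≠ d → 1 ≤ ‖c - d‖
  have hp0 : p 0 := ⟨∅, by simp⟩
  -- A `1`-separated set of largest cardinality is a net: a point farther than `1` from all of it
  -- could be added. The volumetric bound `5 ^ d` ensures that a largest cardinality exists.
  obtain ⟨F, hFc, hF2, hFs⟩ := Nat.findGreatest_spec (P := p)
    (n := 5 ^ Module.finrank ℝ E) (Nat.zero_le _) hp0
  refine ⟨F, Besicovitch.card_le_of_separated F hF2 hFs, hF2, fun x hx => ?_⟩
  by_contra! hcon
  have hxF : x ∉ F := fun h => by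
    have := hcon x h
    simp at this
    linarith
  have hnew : p (F.card + 1) := by
    refine ⟨insert x F, Finset.card_insert_of_notMem hxF, ?_, ?_⟩
    · intro c hc
      rcases Finset.mem_insert.1 hc with rfl | hc
      exacts [hx, hF2 c hc]
    · intro c hc d hd hcd
      rcases Finset.mem_insert.1 hc with rfl | hc' <;> rcases Finset.mem_insert.1 hd with rfl | hd'
      · exact absurd rfl hcd
      · exact (hcon d hd').le
      · rw [norm_sub_rev]; exact (hcon c hc').le
      · exact hFs c hc' d hd' hcd
  have hle : F.card + 1 ≤ 5 ^ Module.finrank ℝ E := by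
    obtain ⟨s, hs, h2, h3⟩ := hnew
    rw [← hs]
    exact Besicovitch.card_le_of_separated s h2 h3
  have := Nat.le_findGreatest hle hnew
  omega

/-- Dyadic expansion of a point of the ball of radius `2` in terms of a `1`-net. -/
lemma exists_dyadic_expansion {E : Type*} [NormedAddCommGroup E] [NormedSpace ℝ E] {F : Finset E}
    (hF : ∀ x : E, ‖x‖ ≤ 2 → ∃ f ∈ F, ‖x - f‖ ≤ 1) (x : E) (hx : ‖x‖ ≤ 2) :
    ∃ f : ℕ → F, ∀ n, ‖x - ∑ k ∈ Finset.range n, (1 / 2 : ℝ) ^ k • (f k : E)‖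
      ≤ 2 * (1 / 2) ^ n := by
  choose! c hc hc1 using hF
  -- The remainder after a net approximation has norm at most `1`; doubling it returns it to the
  -- ball of radius `2`, where the same net applies again.
  let y : ℕ → E := fun k => Nat.rec x (fun _ z => (2 : ℝ) • (z - c z)) k
  have hy : ∀ k, ‖y k‖ ≤ 2 := by
    intro k
    induction k with
    | zero => exact hx
    | succ k ih =>
      change ‖(2 : ℝ) • (y k - c (y k))‖ ≤ 2
      rw [norm_smul]
      have := hc1 _ ih
      norm_num
      linarith
  have hsum : ∀ n, x - ∑ k ∈ Finset.range n, (1 / 2 : ℝ) ^ k • c (y k) = (1 / 2 : ℝ) ^ n • y n := by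
    intro n
    induction n with
    | zero => simp [y]
    | succ n ih =>
      rw [Finset.sum_range_succ, ← sub_sub, ih]
      change _ = (1 / 2 : ℝ) ^ (n + 1) • ((2 : ℝ) • (y n - c (y n)))
      rw [smul_smul, pow_succ, mul_assoc]
      norm_num
      rw [smul_sub]
  refine ⟨fun k => ⟨c (y k), hc _ (hy k)⟩, fun n => ?_⟩
  simp only [hsum]
  rw [norm_smul, mul_comm, Real.norm_of_nonneg (by positivity)]
  exact mul_le_mul_of_nonneg_right (hy n) (by positivity)

variable {Z : Type*} [MeasurableSpace Z]

/-- Deviation of the empirical mean of `h` on the sample `S` from its mean under `P`. -/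
noncomputable def empDev (P : Measure Z) {N : ℕ} (h : Z → ℝ) (S : Fin N → Z) : ℝ :=
  (∑ i, h (S i)) / N - ∫ z, h z ∂P

lemma empDev_sub {P : Measure Z} {N : ℕ} {g h : Z → ℝ} (hg : Integrable g P) (hh : Integrable h P)
    (S : Fin N → Z) :
    empDev P (fun z => g z - h z) S = empDev P g S - empDev P h S := by
  simp only [empDev, integral_sub hg hh, Finset.sum_sub_distrib]
  ring

lemma measure_pi_empDev_ge_le (P : Measure Z) [IsProbabilityMeasure P] {N : ℕ} (hN : 1 ≤ N)
    {h : Z → ℝ} (hm : AEMeasurable h P) {a : ℝ} (ha : 0 < a) (hb : ∀ᵐ z ∂P, |h z| ≤ a)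
    {q : ℝ} (hq : 0 ≤ q) :
    (Measure.pi fun _ : Fin N => P).real {S | a * Real.sqrt (2 * q / N) ≤ empDev P h S}
      ≤ Real.exp (-q) := by
  have hN' : (0 : ℝ) < N := by exact_mod_cast hN
  have hsub := hasSubgaussianMGF_of_mem_Icc (a := -a) (b := a) hm
    (hb.mono fun z hz => abs_le.1 hz)
  have hind : iIndepFun (fun (i : Fin N) (S : Fin N → Z) => h (S i) - ∫ z, h z ∂P)
      (Measure.pi fun _ : Fin N => P) :=
    iIndepFun_pi (X := fun _ z => h z - ∫ z, h z ∂P) fun _ => hm.sub_const _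
  have hsubi : ∀ i ∈ (Finset.univ : Finset (Fin N)),
      HasSubgaussianMGF (fun S : Fin N → Z => h (S i) - ∫ z, h z ∂P)
        ((‖a - -a‖₊ / 2) ^ 2) (Measure.pi fun _ : Fin N => P) := by
    intro i _
    have hmp := measurePreserving_eval (fun _ : Fin N => P) i
    have := HasSubgaussianMGF.of_map (μ := Measure.pi fun _ : Fin N => P)
      (Y := Function.eval i) (X := fun z => h z - ∫ z, h z ∂P) hmp.measurable.aemeasurable
      (by rw [hmp.map_eq]; exact hsub)
    exact this
  have key := HasSubgaussianMGF.measure_sum_ge_le_of_iIndepFun hind hsubi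
    (ε := a * Real.sqrt (2 * q * N)) (by positivity)
  have hset : {S : Fin N → Z | a * Real.sqrt (2 * q / N) ≤ empDev P h S} =
      {S | a * Real.sqrt (2 * q * N) ≤ ∑ i, (h (S i) - ∫ z, h z ∂P)} := by
    have hs : Real.sqrt (2 * q * N) = N * Real.sqrt (2 * q / N) := by
      rw [show 2 * q * (N : ℝ) = N ^ 2 * (2 * q / N) by field_simp,
        Real.sqrt_mul (by positivity), Real.sqrt_sq hN'.le]
    ext S
    simp only [Set.mem_ofPred_eq, empDev, hs, Finset.sum_sub_distrib, Finset.sum_const,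
      Finset.card_univ, Fintype.card_fin, nsmul_eq_mul]
    rw [le_sub_iff_add_le, le_sub_iff_add_le, le_div_iff₀ hN']
    constructor <;> intro h1 <;> nlinarith
  rw [hset]
  -- The sum has variance proxy `N a²`, so the threshold `a √(2qN)` gives exponent exactly `-q`.
  refine key.trans (Real.exp_le_exp.2 (le_of_eq ?_))
  simp only [Finset.sum_const, Finset.card_univ, Fintype.card_fin, nsmul_eq_mul]
  push_cast
  rw [mul_pow, Real.sq_sqrt (by positivity), Real.norm_of_nonneg (by linarith)]
  field_simp
  ring

/-- Hoeffding's inequality for the empirical mean of a bounded function. -/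
lemma measure_pi_abs_empDev_gt_le (P : Measure Z) [IsProbabilityMeasure P] {N : ℕ} (hN : 1 ≤ N)
    {h : Z → ℝ} (hm : AEMeasurable h P) {a : ℝ} (ha : 0 ≤ a) (hb : ∀ᵐ z ∂P, |h z| ≤ a)
    {q : ℝ} (hq : 0 ≤ q) :
    (Measure.pi fun _ : Fin N => P) {S | a * Real.sqrt (2 * q / N) < |empDev P h S|}
      ≤ ENNReal.ofReal (2 * Real.exp (-q)) := by
  -- At `a = 0` the non-strict one-sided event is everything when `h` vanishes, so this case is
  -- separate: the strict event here is null.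
  rcases ha.eq_or_lt with rfl | ha
  · have hz : h =ᵐ[P] 0 := hb.mono fun z hz => by simpa using hz
    have hall : ∀ᵐ S ∂(Measure.pi fun _ : Fin N => P), ∀ i, h (S i) = 0 :=
      ae_all_iff.2 fun i =>
        (measurePreserving_eval (fun _ : Fin N => P) i).quasiMeasurePreserving.ae hz
    have h0 : (Measure.pi fun _ : Fin N => P)
        {S | 0 * Real.sqrt (2 * q / N) < |empDev P h S|} = 0 := by
      refine measure_mono_null ?_ hall
      intro S hS hS'
      have hS0 : ∀ i, h (S i) = 0 := hS'
      simp [empDev, hS0, integral_congr_ae hz] at hS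
    rw [h0]
    exact zero_le
  · have hneg : ∀ S : Fin N → Z, empDev P (fun z => -h z) S = -empDev P h S := by
      intro S
      simp [empDev, integral_neg, neg_div]
      ring
    have h1 := measure_pi_empDev_ge_le P hN hm ha hb hq
    have h2 := measure_pi_empDev_ge_le P hN hm.neg ha (h := fun z => -h z) (by simpa using hb) hq
    simp only [hneg] at h2
    have hsub : {S : Fin N → Z | a * Real.sqrt (2 * q / N) < |empDev P h S|} ⊆
        {S | a * Real.sqrt (2 * q / N) ≤ empDev P h S} ∪
          {S | a * Real.sqrt (2 * q / N) ≤ -empDev P h S} := by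
      intro S hS
      rw [Set.mem_ofPred_eq] at hS
      rcases lt_abs.1 hS with h | h
      exacts [Or.inl h.le, Or.inr h.le]
    refine (measure_mono hsub).trans ((measure_union_le _ _).trans ?_)
    rw [two_mul (Real.exp _), ENNReal.ofReal_add (Real.exp_pos _).le (Real.exp_pos _).le,
      ← ofReal_measureReal, ← ofReal_measureReal]
    exact add_le_add (ENNReal.ofReal_le_ofReal h1) (ENNReal.ofReal_le_ofReal h2)

lemma sum_range_succ_mul_half_pow_le (n : ℕ) :
    ∑ k ∈ Finset.range n, ((k : ℝ) + 1) * (1 / 2) ^ k ≤ 4 := by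
  have h : ∀ n : ℕ, ∑ k ∈ Finset.range n, ((k : ℝ) + 1) * (1 / 2) ^ k
      = 4 - (2 * n + 4) * (1 / 2) ^ n := by
    intro n
    induction n with
    | zero => norm_num
    | succ n ih => rw [Finset.sum_range_succ, ih, pow_succ]; push_cast; ring
  rw [h]
  have : (0 : ℝ) ≤ (2 * n + 4) * (1 / 2) ^ n := by positivity
  linarith

/-- Entropy against concentration: an exponent `3 d` per chain level pays for the `5 ^ d` net points
and leaves a geometric factor for the sum over levels. -/
lemma five_pow_mul_exp_le {d : ℕ} (hd : 1 ≤ d) : (5 : ℝ) ^ d * Real.exp (-(3 * d)) ≤ 1 / 2 := by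
  have h1 : Real.exp (-(3 * d)) = (Real.exp (-3)) ^ d := by
    rw [← Real.exp_nat_mul]; ring_nf
  have h3 : (10 : ℝ) ≤ Real.exp 3 := by
    have h := Real.exp_one_gt_d9
    have : Real.exp 3 = Real.exp 1 ^ 3 := by rw [← Real.exp_nat_mul]; norm_num
    rw [this]
    calc (10 : ℝ) ≤ 2.7 ^ 3 := by norm_num
      _ ≤ _ := pow_le_pow_left₀ (by norm_num) (by linarith) 3
  have h2 : 5 * Real.exp (-3) ≤ 1 / 2 := by
    rw [Real.exp_neg, ← div_eq_mul_inv, div_le_iff₀ (Real.exp_pos _)]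
    linarith
  rw [h1, ← mul_pow]
  calc (5 * Real.exp (-3)) ^ d ≤ (5 * Real.exp (-3)) ^ 1 :=
        pow_le_pow_of_le_one (by positivity) (by linarith) hd
    _ ≤ 1 / 2 := by simpa using h2

lemma tsum_half_pow_succ_ofReal {δ : ℝ} (hδ : 0 ≤ δ) :
    ∑' n : ℕ, ENNReal.ofReal (δ * (1 / 2) ^ (n + 1)) = ENNReal.ofReal δ := by
  have hs : HasSum (fun n : ℕ => δ * (1 / 2 : ℝ) ^ (n + 1)) δ := by
    have := (hasSum_geometric_two.mul_left (δ / 2))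
    convert! this using 1
    · ext n; rw [pow_succ]; ring
    · ring
  rw [← ENNReal.ofReal_tsum_of_nonneg (fun n => by positivity) hs.summable, hs.tsum_eq]

/-- Chaining bound: a family of functions, Lipschitz in a `d`-dimensional parameter, has uniformly
small empirical deviations over the ball of radius `2`. -/
theorem measure_pi_exists_empDev_gt_le {E : Type*} [NormedAddCommGroup E] [NormedSpace ℝ E]
    [FiniteDimensional ℝ E] (P : Measure Z) [IsProbabilityMeasure P] {N : ℕ} (hN : 1 ≤ N)
    (hd : 1 ≤ Module.finrank ℝ E) {g : E → Z → ℝ} (hm : ∀ θ, AEMeasurable (g θ) P)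
    (h0 : ∀ z, g 0 z = 0) {L : ℝ} (hL : 0 ≤ L)
    (hLip : ∀ᵐ z ∂P, ∀ θ θ' : E, ‖θ‖ ≤ 4 → ‖θ'‖ ≤ 4 → |g θ z - g θ' z| ≤ L * ‖θ - θ'‖)
    {δ : ℝ} (hδ : 0 < δ) (hδ1 : δ ≤ 1) :
    (Measure.pi fun _ : Fin N => P) {S | ∃ θ : E, ‖θ‖ ≤ 2 ∧
      8 * L * Real.sqrt (2 * (3 * Module.finrank ℝ E + Real.log (2 / δ)) / N) < |empDev P (g θ) S|}
      ≤ ENNReal.ofReal δ := by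
  classical
  set d := Module.finrank ℝ E with hd_def
  -- `3 * d` pays for the net, and `log (2 / δ)` turns the factor `2` of two-sided Hoeffding into
  -- `δ`.
  set q : ℝ := 3 * d + Real.log (2 / δ) with hq_def
  have hN' : (0 : ℝ) < N := by exact_mod_cast hN
  have hlog : 0 ≤ Real.log (2 / δ) := Real.log_nonneg (by rw [le_div_iff₀ hδ]; linarith)
  have hq : 0 ≤ q := by positivity
  obtain ⟨F, hFc, hF2, hFnet⟩ := exists_net_closedBall E
  have hint : ∀ θ : E, ‖θ‖ ≤ 4 → Integrable (g θ) P := by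
    intro θ hθ
    refine Integrable.of_bound (hm θ).aestronglyMeasurable (L * 4) ?_
    filter_upwards [hLip] with z hz
    have := hz θ 0 hθ (by simp)
    rw [h0, sub_zero, sub_zero] at this
    exact this.trans (mul_le_mul_of_nonneg_left hθ hL)
  let pt : (n : ℕ) → (ℕ → F) → E := fun n f => ∑ k ∈ Finset.range n, (1 / 2 : ℝ) ^ k • (f k : E)
  have hpt : ∀ n f, ‖pt n f‖ ≤ 4 := by
    intro n f
    refine (norm_sum_le _ _).trans ((Finset.sum_le_sum (g := fun k : ℕ => 2 * (1 / 2 : ℝ) ^ k)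
      fun k _ => ?_).trans ?_)
    · rw [norm_smul, mul_comm, Real.norm_of_nonneg (by positivity)]
      exact mul_le_mul_of_nonneg_right (hF2 _ (f k).2) (by positivity)
    · rw [← Finset.mul_sum]
      have := Summable.sum_le_tsum (f := fun k : ℕ => (1 / 2 : ℝ) ^ k) (Finset.range n)
        (fun k _ => by positivity) summable_geometric_two
      rw [tsum_geometric_two] at this
      linarith
  -- the finitely many chains of each length
  obtain hne | hne := F.eq_empty_or_nonempty
  · obtain ⟨f, hf, -⟩ := hFnet 0 (by simp)
    simp [hne] at hf
  obtain ⟨f₀, hf₀⟩ := hne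
  -- The link at level `n` depends only on the first `n + 1` letters of a chain, so the default
  -- letter `f₀` is irrelevant and finitely many words suffice. Whole words are needed because `g`
  -- is not linear in its parameter.
  let ext : (n : ℕ) → (Fin (n + 1) → F) → ℕ → F := fun n w k =>
    if h : k < n + 1 then w ⟨k, h⟩ else ⟨f₀, hf₀⟩
  let link : (n : ℕ) → (ℕ → F) → Z → ℝ := fun n f z => g (pt (n + 1) f) z - g (pt n f) z
  let a : ℕ → ℝ := fun n => L * (2 * (1 / 2) ^ n)
  -- There are up to `5 ^ (d (n + 1))` words at level `n`, so the exponent grows linearly in `n`;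
  -- the link sizes `a n` decay geometrically and absorb this.
  let s : ℕ → ℝ := fun n => (n + 1) * q
  let bad : (n : ℕ) → (Fin (n + 1) → F) → Set (Fin N → Z) := fun n w =>
    {S | a n * Real.sqrt (2 * s n / N) < |empDev P (link n (ext n w)) S|}
  have hbad : ∀ n w, (Measure.pi fun _ : Fin N => P) (bad n w)
      ≤ ENNReal.ofReal (2 * Real.exp (-(s n))) := by
    intro n w
    refine measure_pi_abs_empDev_gt_le P hN ((hm _).sub (hm _)) (by positivity) ?_ (by positivity)
    filter_upwards [hLip] with z hz
    refine (hz _ _ (hpt _ _) (hpt _ _)).trans (mul_le_mul_of_nonneg_left ?_ hL)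
    simp only [pt, Finset.sum_range_succ, add_sub_cancel_left]
    rw [norm_smul, mul_comm, Real.norm_of_nonneg (by positivity)]
    exact mul_le_mul_of_nonneg_right (hF2 _ (ext n w n).2) (by positivity)
  have hbadsum : ∀ n, (Measure.pi fun _ : Fin N => P) (⋃ w, bad n w)
      ≤ ENNReal.ofReal (δ * (1 / 2) ^ (n + 1)) := by
    intro n
    refine (measure_iUnion_fintype_le _ _).trans ((Finset.sum_le_sum fun w _ => hbad n w).trans ?_)
    rw [Finset.sum_const, nsmul_eq_mul, ← ENNReal.ofReal_natCast, ← ENNReal.ofReal_mul (by positivity)]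
    apply ENNReal.ofReal_le_ofReal
    have hcard : ((Finset.univ : Finset (Fin (n + 1) → F)).card : ℝ) ≤ ((5 : ℝ) ^ d) ^ (n + 1) := by
      rw [Finset.card_univ, Fintype.card_fun, Fintype.card_coe, Fintype.card_fin]
      push_cast
      exact pow_le_pow_left₀ (by positivity) (by exact_mod_cast hFc) _
    have hexp : Real.exp (-(s n)) ≤ Real.exp (-(3 * d)) ^ (n + 1) * (δ / 2) := by
      have h2 : δ / 2 = Real.exp (-Real.log (2 / δ)) := by
        rw [Real.exp_neg, Real.exp_log (by positivity), inv_div]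
      rw [h2, ← Real.exp_nat_mul, ← Real.exp_add]
      apply Real.exp_le_exp.2
      simp only [s, hq_def]
      push_cast
      nlinarith [mul_nonneg (Nat.cast_nonneg (α := ℝ) n) hlog]
    calc _ ≤ ((5 : ℝ) ^ d) ^ (n + 1) * (2 * (Real.exp (-(3 * d)) ^ (n + 1) * (δ / 2))) := by gcongr
      _ = δ * (5 ^ d * Real.exp (-(3 * d))) ^ (n + 1) := by rw [mul_pow]; ring
      _ ≤ _ := by
        gcongr
        exact five_pow_mul_exp_le hd
  have hgood : ∀ᵐ S ∂(Measure.pi fun _ : Fin N => P), ∀ i, ∀ θ θ' : E, ‖θ‖ ≤ 4 → ‖θ'‖ ≤ 4 →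
      |g θ (S i) - g θ' (S i)| ≤ L * ‖θ - θ'‖ :=
    ae_all_iff.2 fun i =>
      (measurePreserving_eval (fun _ : Fin N => P) i).quasiMeasurePreserving.ae hLip
  have hunion : (Measure.pi fun _ : Fin N => P) (⋃ n, ⋃ w, bad n w) ≤ ENNReal.ofReal δ :=
    (measure_iUnion_le _).trans ((ENNReal.tsum_le_tsum hbadsum).trans
      (tsum_half_pow_succ_ofReal hδ.le).le)
  -- The event ranges over all `θ`. Almost sure inclusion in the countable union of bad events
  -- bounds its outer measure, without any measurability of the event.
  refine (measure_mono_ae ?_).trans hunion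
  filter_upwards [hgood] with S hS hθ
  obtain ⟨θ, hθ2, hgt⟩ := hθ
  by_contra hnot
  have hnot' : ∀ n w, |empDev P (link n (ext n w)) S| ≤ a n * Real.sqrt (2 * s n / N) := by
    intro n w
    by_contra! hlt
    exact hnot (Set.mem_iUnion.2 ⟨n, Set.mem_iUnion.2 ⟨w, hlt⟩⟩)
  obtain ⟨f, hf⟩ := exists_dyadic_expansion hFnet θ hθ2
  have hptext : ∀ n k, k ≤ n + 1 → pt k (ext n fun i => f i) = pt k f := by
    intro n k hk
    refine Finset.sum_congr rfl fun i hi => ?_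
    have : i < n + 1 := lt_of_lt_of_le (Finset.mem_range.1 hi) hk
    simp only [ext, dif_pos this]
  have hlink : ∀ n, |empDev P (g (pt (n + 1) f)) S - empDev P (g (pt n f)) S|
      ≤ 2 * L * Real.sqrt (2 * q / N) * ((n + 1) * (1 / 2) ^ n) := by
    intro n
    rw [← empDev_sub (hint _ (hpt _ _)) (hint _ (hpt _ _))]
    have h1 := hnot' n fun i => f i
    simp only [link, hptext n (n + 1) le_rfl, hptext n n (Nat.le_succ n)] at h1
    refine h1.trans ?_
    -- Using `√(n+1) ≤ n+1` makes the sum over levels explicit, with value at most `4`; this is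
    -- where `8 = 2 · 4` comes from.
    have h2 : Real.sqrt (2 * s n / N) ≤ (n + 1) * Real.sqrt (2 * q / N) := by
      rw [show 2 * s n / N = (n + 1) * (2 * q / N) by simp only [s]; ring,
        Real.sqrt_mul (by positivity)]
      gcongr
      rw [Real.sqrt_le_left (by positivity)]
      nlinarith [Nat.cast_nonneg (α := ℝ) n]
    calc _ ≤ a n * ((n + 1) * Real.sqrt (2 * q / N)) :=
          mul_le_mul_of_nonneg_left h2 (by positivity)
      _ = _ := by simp only [a]; ring
  have hpartial : ∀ n, |empDev P (g (pt n f)) S| ≤ 8 * L * Real.sqrt (2 * q / N) := by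
    intro n
    have h1 : |empDev P (g (pt n f)) S| ≤ 2 * L * Real.sqrt (2 * q / N) *
        ∑ k ∈ Finset.range n, ((k : ℝ) + 1) * (1 / 2) ^ k := by
      induction n with
      | zero => simp [pt, empDev, h0]
      | succ n ih =>
        rw [Finset.sum_range_succ, mul_add]
        have h := abs_add_le (empDev P (g (pt n f)) S)
          (empDev P (g (pt (n + 1) f)) S - empDev P (g (pt n f)) S)
        rw [add_sub_cancel] at h
        exact h.trans (add_le_add ih (hlink n))
    refine h1.trans ?_
    calc _ ≤ 2 * L * Real.sqrt (2 * q / N) * 4 :=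
          mul_le_mul_of_nonneg_left (sum_range_succ_mul_half_pow_le n) (by positivity)
      _ = _ := by ring
  have hθ4 : ‖θ‖ ≤ 4 := by linarith
  -- The Lipschitz bound holds at the sample points and almost everywhere under `P`, so both the
  -- empirical mean and the integral pass to the limit of the chain.
  have hlim : ∀ n, |empDev P (g θ) S - empDev P (g (pt n f)) S| ≤ 4 * L * (1 / 2) ^ n := by
    intro n
    have hfn := hf n
    have hA : |(∑ i, (g θ (S i) - g (pt n f) (S i))) / N| ≤ L * (2 * (1 / 2) ^ n) := by
      rw [abs_div, Nat.abs_cast, div_le_iff₀ hN']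
      refine (Finset.abs_sum_le_sum_abs _ _).trans ((Finset.sum_le_sum fun i _ =>
        (hS i θ (pt n f) hθ4 (hpt _ _)).trans (mul_le_mul_of_nonneg_left hfn hL)).trans ?_)
      simp [mul_comm]
    have hB : |∫ z, (g θ z - g (pt n f) z) ∂P| ≤ L * (2 * (1 / 2) ^ n) := by
      have := norm_integral_le_of_norm_le_const (μ := P) (f := fun z => g θ z - g (pt n f) z)
        (C := L * (2 * (1 / 2) ^ n)) (by
          filter_upwards [hLip] with z hz
          exact (hz θ (pt n f) hθ4 (hpt _ _)).trans (mul_le_mul_of_nonneg_left hfn hL))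
      simpa using this
    rw [← empDev_sub (hint _ hθ4) (hint _ (hpt _ _)), empDev]
    refine (abs_sub _ _).trans ((add_le_add hA hB).trans (le_of_eq (by ring)))
  have hfinal : |empDev P (g θ) S| ≤ 8 * L * Real.sqrt (2 * q / N) := by
    have ht : Filter.Tendsto (fun n : ℕ => 4 * L * (1 / 2 : ℝ) ^ n + 8 * L * Real.sqrt (2 * q / N))
        Filter.atTop (nhds (4 * L * 0 + 8 * L * Real.sqrt (2 * q / N))) :=
      ((tendsto_pow_atTop_nhds_zero_of_lt_one (by norm_num) (by norm_num)).const_mul _).add_const _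
    rw [mul_zero, zero_add] at ht
    refine ge_of_tendsto' ht fun n => ?_
    have h := abs_add_le (empDev P (g θ) S - empDev P (g (pt n f)) S) (empDev P (g (pt n f)) S)
    rw [sub_add_cancel] at h
    exact h.trans (add_le_add (hlim n) (hpartial n))
  exact absurd hgt (not_lt.2 hfinal)

/-- Integration of a sub-Gaussian upper tail. -/
lemma integral_le_of_forall_measure_gt_le {Ω : Type*} [MeasurableSpace Ω] {μ : Measure Ω}
    [IsProbabilityMeasure μ] {g : Ω → ℝ} (hg : Integrable g μ) {a b : ℝ} (hb : 0 ≤ b)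
    (h : ∀ δ : ℝ, 0 < δ → δ < 1 →
      μ {ω | a + b * Real.sqrt (Real.log (2 / δ)) < g ω} ≤ ENNReal.ofReal δ) :
    ∫ ω, g ω ∂μ ≤ a + 2 * b := by
  refine le_of_forall_pos_le_add fun ε hε => ?_
  -- `b` may vanish; a slightly larger `β` is a legitimate Gaussian width.
  obtain ⟨β, hβb, hβε⟩ : ∃ β, b < β ∧ 2 * β ≤ 2 * b + ε := ⟨b + ε / 2, by linarith, by linarith⟩
  have hβ : 0 < β := hb.trans_lt hβb
  have hint : Integrable (fun ω => max (g ω - a) 0) μ := (hg.sub (integrable_const a)).pos_part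
  have h1 : ∫ ω, g ω ∂μ ≤ a + ∫ ω, max (g ω - a) 0 ∂μ := by
    have h := integral_mono (hg.sub (integrable_const a)) hint fun ω => le_max_left _ _
    simp only [Pi.sub_apply] at h
    rw [integral_sub hg (integrable_const a)] at h
    simp at h
    linarith
  have htail : ∀ t : ℝ, 0 < t → μ.real {ω | t < max (g ω - a) 0}
      ≤ 2 * Real.exp (-(1 / β ^ 2) * t ^ 2) := by
    intro t ht
    set δ := 2 * Real.exp (-(1 / β ^ 2) * t ^ 2) with hδ
    have hδ0 : 0 < δ := by positivity
    rcases lt_or_ge δ 1 with hδ1 | hδ1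
    · refine (ENNReal.toReal_mono ENNReal.ofReal_ne_top
        ((measure_mono ?_).trans (h δ hδ0 hδ1))).trans_eq (ENNReal.toReal_ofReal hδ0.le)
      intro ω hω
      rw [Set.mem_ofPred_eq] at hω ⊢
      have hlog : Real.log (2 / δ) = (t / β) ^ 2 := by
        rw [hδ, ← div_div, div_self two_ne_zero, one_div, ← Real.exp_neg, Real.log_exp]
        field_simp
      rw [hlog, Real.sqrt_sq (by positivity)]
      have hbt : b * (t / β) ≤ t := by
        calc b * (t / β) ≤ β * (t / β) := by gcongr
          _ = t := by field_simp
      rcases lt_max_iff.1 hω with h' | h' <;> linarith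
    · exact measureReal_le_one.trans hδ1
  have h2 : ∫ ω, max (g ω - a) 0 ∂μ ≤ β * Real.sqrt Real.pi := by
    rw [hint.integral_eq_integral_meas_lt (ae_of_all _ fun ω => le_max_right _ _)]
    calc _ ≤ ∫ t in Set.Ioi (0 : ℝ), 2 * Real.exp (-(1 / β ^ 2) * t ^ 2) := by
          refine integral_mono_of_nonneg (ae_of_all _ fun t => measureReal_nonneg)
            ((integrable_exp_neg_mul_sq (by positivity)).integrableOn.const_mul 2) ?_
          filter_upwards [ae_restrict_mem measurableSet_Ioi] with t ht using htail t ht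
      _ = β * Real.sqrt Real.pi := by
          rw [integral_const_mul, integral_gaussian_Ioi, div_div_eq_mul_div, div_one,
            Real.sqrt_mul Real.pi_pos.le, Real.sqrt_sq hβ.le]
          ring
  have hpi : Real.sqrt Real.pi ≤ 2 := by
    rw [Real.sqrt_le_left (by norm_num)]
    linarith [Real.pi_le_four]
  nlinarith

end Chaining

/-! ### Frobenius and spectral norms. -/

section MatrixNorms

variable {a b c : ℕ}

lemma frobNorm_nonneg (A : Matrix (Fin a) (Fin b) ℝ) : 0 ≤ frobNorm A := Real.sqrt_nonneg _

lemma frobNorm_sq (A : Matrix (Fin a) (Fin b) ℝ) : frobNorm A ^ 2 = ∑ i, ∑ j, A i j ^ 2 :=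
  Real.sq_sqrt (by positivity)

@[simp] lemma frobNorm_zero : frobNorm (0 : Matrix (Fin a) (Fin b) ℝ) = 0 := by
  simp [frobNorm]

lemma frobNorm_smul (t : ℝ) (A : Matrix (Fin a) (Fin b) ℝ) :
    frobNorm (t • A) = |t| * frobNorm A := by
  simp only [frobNorm, Matrix.smul_apply, smul_eq_mul, mul_pow, ← Finset.mul_sum]
  rw [Real.sqrt_mul (sq_nonneg t), Real.sqrt_sq_eq_abs]

lemma eq_zero_of_frobNorm_eq_zero {A : Matrix (Fin a) (Fin b) ℝ} (h : frobNorm A = 0) : A = 0 := by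
  have h2 := frobNorm_sq A
  rw [h, zero_pow two_ne_zero] at h2
  ext i j
  have h3 := (Finset.sum_eq_zero_iff_of_nonneg fun i _ => by positivity).1 h2.symm i
    (Finset.mem_univ i)
  have h4 := (Finset.sum_eq_zero_iff_of_nonneg fun i _ => by positivity).1 h3 j
    (Finset.mem_univ j)
  simpa using h4

/-- The matrix with the given vector of entries. -/
def vecToMatrix (w : EuclideanSpace ℝ (Fin a × Fin b)) : Matrix (Fin a) (Fin b) ℝ :=
  Matrix.of fun i j => w (i, j)

/-- The vector of entries of a matrix. -/
def matrixToVec (A : Matrix (Fin a) (Fin b) ℝ) : EuclideanSpace ℝ (Fin a × Fin b) :=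
  WithLp.toLp 2 fun p => A p.1 p.2

lemma vecToMatrix_matrixToVec (A : Matrix (Fin a) (Fin b) ℝ) :
    vecToMatrix (matrixToVec A) = A := rfl

lemma frobNorm_vecToMatrix (w : EuclideanSpace ℝ (Fin a × Fin b)) :
    frobNorm (vecToMatrix w) = ‖w‖ := by
  rw [EuclideanSpace.norm_eq, frobNorm, Fintype.sum_prod_type]
  simp [vecToMatrix]

lemma norm_matrixToVec (A : Matrix (Fin a) (Fin b) ℝ) : ‖matrixToVec A‖ = frobNorm A := by
  rw [← frobNorm_vecToMatrix, vecToMatrix_matrixToVec]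

lemma vecToMatrix_sub (w w' : EuclideanSpace ℝ (Fin a × Fin b)) :
    vecToMatrix (w - w') = vecToMatrix w - vecToMatrix w' := rfl

@[simp] lemma vecToMatrix_zero : vecToMatrix (0 : EuclideanSpace ℝ (Fin a × Fin b)) = 0 := rfl

lemma frobInner_eq_sum (A D : Matrix (Fin a) (Fin b) ℝ) :
    frobInner A D = ∑ i, ∑ j, A i j * D i j := by
  rw [Finset.sum_comm]
  simp [frobInner, Matrix.trace, Matrix.mul_apply]

lemma frobInner_sub (A D D' : Matrix (Fin a) (Fin b) ℝ) :
    frobInner A (D - D') = frobInner A D - frobInner A D' := by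
  simp [frobInner, Matrix.mul_sub]

lemma frobInner_add (A D D' : Matrix (Fin a) (Fin b) ℝ) :
    frobInner A (D + D') = frobInner A D + frobInner A D' := by
  simp [frobInner, Matrix.mul_add]

lemma frobInner_eq_inner (A D : Matrix (Fin a) (Fin b) ℝ) :
    frobInner A D = inner ℝ (matrixToVec D) (matrixToVec A) := by
  rw [frobInner_eq_sum, PiLp.inner_apply, Fintype.sum_prod_type]
  simp [matrixToVec]

lemma frobNorm_mul_transpose_le (u : Matrix (Fin a) (Fin c) ℝ) (v : Matrix (Fin b) (Fin c) ℝ) :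
    frobNorm (u * v.transpose) ≤ frobNorm u * frobNorm v := by
  refine le_of_sq_le_sq ?_ (mul_nonneg (frobNorm_nonneg _) (frobNorm_nonneg _))
  rw [mul_pow, frobNorm_sq, frobNorm_sq, frobNorm_sq, Finset.sum_mul_sum]
  refine Finset.sum_le_sum fun i _ => Finset.sum_le_sum fun j _ => ?_
  rw [Matrix.mul_apply]
  exact Finset.sum_mul_sq_le_sq_mul_sq _ _ _

lemma norm_mulVec_le_specNorm (G : Matrix (Fin a) (Fin b) ℝ) (x : Fin b → ℝ) :
    ‖WithLp.toLp 2 (G.mulVec x)‖ ≤ specNorm G * ‖WithLp.toLp 2 x‖ := by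
  have := (LinearMap.toContinuousLinearMap (Matrix.toEuclideanLin G)).le_opNorm (WithLp.toLp 2 x)
  simpa [specNorm] using this

lemma specNorm_nonneg (G : Matrix (Fin a) (Fin b) ℝ) : 0 ≤ specNorm G := norm_nonneg _

/-- Duality of the spectral norm with products of two factors. -/
lemma abs_frobInner_mul_transpose_le (G : Matrix (Fin a) (Fin b) ℝ)
    (u : Matrix (Fin a) (Fin c) ℝ) (v : Matrix (Fin b) (Fin c) ℝ) :
    |frobInner G (u * v.transpose)| ≤ specNorm G * (frobNorm u * frobNorm v) := by
  let uc : Fin c → EuclideanSpace ℝ (Fin a) := fun k => WithLp.toLp 2 fun i => u i k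
  let vc : Fin c → EuclideanSpace ℝ (Fin b) := fun k => WithLp.toLp 2 fun j => v j k
  -- By columns, `tr (Gᵀ u vᵀ) = ∑ ⟨u_k, G v_k⟩`; Cauchy–Schwarz over `k` then recovers the
  -- Frobenius norms.
  have h1 : frobInner G (u * v.transpose) =
      ∑ k, inner ℝ (uc k) (WithLp.toLp 2 (G.mulVec fun j => v j k)) := by
    simp only [frobInner_eq_sum, PiLp.inner_apply, uc, Matrix.mul_apply, Matrix.transpose_apply,
      Matrix.mulVec, dotProduct, Finset.mul_sum, RCLike.inner_apply, conj_trivial, Finset.sum_mul]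
    conv_rhs => rw [Finset.sum_comm]
    refine Finset.sum_congr rfl fun i _ => ?_
    rw [Finset.sum_comm]
    exact Finset.sum_congr rfl fun k _ => Finset.sum_congr rfl fun j _ => by ring
  have hu : Real.sqrt (∑ k, ‖uc k‖ ^ 2) = frobNorm u := by
    rw [frobNorm, Finset.sum_comm]
    simp [uc, EuclideanSpace.norm_sq_eq]
  have hv : Real.sqrt (∑ k, ‖vc k‖ ^ 2) = frobNorm v := by
    rw [frobNorm, Finset.sum_comm]
    simp [vc, EuclideanSpace.norm_sq_eq]
  rw [h1]
  calc _ ≤ ∑ k, ‖uc k‖ * (specNorm G * ‖vc k‖) := by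
        refine (Finset.abs_sum_le_sum_abs _ _).trans (Finset.sum_le_sum fun k _ => ?_)
        exact (abs_real_inner_le_norm _ _).trans
          (mul_le_mul_of_nonneg_left (norm_mulVec_le_specNorm G _) (norm_nonneg _))
    _ = specNorm G * ∑ k, ‖uc k‖ * ‖vc k‖ := by
        rw [Finset.mul_sum]
        exact Finset.sum_congr rfl fun k _ => by ring
    _ ≤ _ := by
        refine mul_le_mul_of_nonneg_left ?_ (specNorm_nonneg G)
        rw [← hu, ← hv]
        exact Real.sum_mul_le_sqrt_mul_sqrt _ _ _

/-- Each of the `b` columns is the image of a unit basis vector. -/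
lemma frobNorm_sq_le_specNorm_sq (G : Matrix (Fin a) (Fin b) ℝ) :
    frobNorm G ^ 2 ≤ b * specNorm G ^ 2 := by
  rw [frobNorm_sq, Finset.sum_comm]
  have h : ∀ j, ∑ i, G i j ^ 2 ≤ specNorm G ^ 2 := by
    intro j
    have h1 := norm_mulVec_le_specNorm G (Pi.single j 1)
    rw [Matrix.mulVec_single_one] at h1
    have h2 : ‖(WithLp.toLp 2 (Pi.single j 1) : EuclideanSpace ℝ (Fin b))‖ = 1 := by
      simp
    rw [h2, mul_one] at h1
    have h3 := pow_le_pow_left₀ (norm_nonneg _) h1 2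
    simpa [EuclideanSpace.norm_sq_eq] using h3
  refine (Finset.sum_le_sum fun j _ => h j).trans ?_
  simp

end MatrixNorms

/-! ### Cross-entropy: sign and Lipschitz continuity. -/

section CrossEntropy

variable {K : ℕ}

lemma ceLoss_eq {y : Fin K → ℝ} (hy : y ∈ stdSimplex ℝ (Fin K)) (a : Fin K → ℝ) :
    ceLoss a y = Real.log (∑ k, Real.exp (a k)) - ∑ j, y j * a j := by
  rcases isEmpty_or_nonempty (Fin K) with h | h
  · have := hy.2
    simp at this
  have hpos : 0 < ∑ k, Real.exp (a k) :=
    Finset.sum_pos (fun k _ => Real.exp_pos _) Finset.univ_nonempty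
  have h1 : ∀ j, Real.log (softmax a j) = a j - Real.log (∑ k, Real.exp (a k)) := fun j => by
    rw [softmax, Real.log_div (Real.exp_pos _).ne' hpos.ne', Real.log_exp]
  simp only [ceLoss, h1, mul_sub, Finset.sum_sub_distrib, ← Finset.sum_mul, hy.2, one_mul]
  ring

lemma ceLoss_nonneg {y : Fin K → ℝ} (hy : y ∈ stdSimplex ℝ (Fin K)) (a : Fin K → ℝ) :
    0 ≤ ceLoss a y := by
  rw [ceLoss, neg_nonneg]
  refine Finset.sum_nonpos fun j _ => mul_nonpos_of_nonneg_of_nonpos (hy.1 j) ?_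
  have hj : Real.exp (a j) ≤ ∑ k, Real.exp (a k) :=
    Finset.single_le_sum (f := fun k => Real.exp (a k)) (fun k _ => (Real.exp_pos _).le)
      (Finset.mem_univ j)
  have hs : 0 ≤ softmax a j := div_nonneg (Real.exp_pos _).le ((Real.exp_pos _).le.trans hj)
  exact Real.log_nonpos hs (div_le_one_of_le₀ hj ((Real.exp_pos _).le.trans hj))

/-- The cross-entropy loss is `2`-Lipschitz in the logits for the supremum norm. -/
lemma abs_ceLoss_sub_le {y : Fin K → ℝ} (hy : y ∈ stdSimplex ℝ (Fin K)) {a a' : Fin K → ℝ} {ε : ℝ}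
    (h : ∀ j, |a j - a' j| ≤ ε) : |ceLoss a y - ceLoss a' y| ≤ 2 * ε := by
  rcases isEmpty_or_nonempty (Fin K) with hK | hK
  · have := hy.2
    simp at this
  have key : ∀ a a' : Fin K → ℝ, (∀ j, |a j - a' j| ≤ ε) → ceLoss a y - ceLoss a' y ≤ 2 * ε := by
    intro a a' h
    have hpos : ∀ a : Fin K → ℝ, 0 < ∑ k, Real.exp (a k) := fun a =>
      Finset.sum_pos (fun k _ => Real.exp_pos _) Finset.univ_nonempty
    -- Log-sum-exp and the average against `y` are each `1`-Lipschitz for the sup norm; hence the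
    -- constant `2`, free of `K`.
    have h1 : Real.log (∑ k, Real.exp (a k)) ≤ ε + Real.log (∑ k, Real.exp (a' k)) := by
      have he : ε + Real.log (∑ k, Real.exp (a' k)) =
          Real.log (Real.exp ε * ∑ k, Real.exp (a' k)) := by
        rw [Real.log_mul (Real.exp_pos _).ne' (hpos a').ne', Real.log_exp]
      rw [he]
      refine Real.log_le_log (hpos a) ?_
      rw [Finset.mul_sum]
      refine Finset.sum_le_sum fun k _ => ?_
      rw [← Real.exp_add]
      exact Real.exp_le_exp.2 (by linarith [(abs_le.1 (h k)).2])
    have h2 : ∑ j, y j * a' j - ∑ j, y j * a j ≤ ε := by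
      rw [← Finset.sum_sub_distrib]
      calc _ ≤ ∑ j, y j * ε := by
            refine Finset.sum_le_sum fun j _ => ?_
            rw [← mul_sub]
            exact mul_le_mul_of_nonneg_left (by linarith [(abs_le.1 (h j)).1]) (hy.1 j)
        _ = ε := by rw [← Finset.sum_mul, hy.2, one_mul]
    rw [ceLoss_eq hy, ceLoss_eq hy]
    linarith
  exact abs_sub_le_iff.2 ⟨key a a' h, key a' a fun j => by rw [abs_sub_comm]; exact h j⟩

end CrossEntropy

/-! ### Rademacher sums and the complexity of the low-rank class. -/

section Rademacher

/-- Summing over the first sign is the parallelogram law; the offset `x` is what lets the induction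
absorb that sign. -/
lemma sum_signs_norm_sq {V : Type*} [NormedAddCommGroup V] [InnerProductSpace ℝ V] {N : ℕ}
    (w : Fin N → V) (x : V) :
    ∑ ε : Fin N → ℤˣ, ‖x + ∑ i, ((ε i : ℤ) : ℝ) • w i‖ ^ 2
      = 2 ^ N * (‖x‖ ^ 2 + ∑ i, ‖w i‖ ^ 2) := by
  induction N generalizing x with
  | zero => simp
  | succ N ih =>
    rw [← (Fin.consEquiv fun _ => ℤˣ).sum_comp, Fintype.sum_prod_type]
    have huniv : (Finset.univ : Finset ℤˣ) = {1, -1} := rfl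
    simp only [Fin.consEquiv_apply, Fin.sum_univ_succ, Fin.cons_zero, Fin.cons_succ, ← add_assoc, ih]
    rw [huniv, Finset.sum_pair (by decide)]
    have hpar := parallelogram_law_with_norm ℝ x (w 0)
    simp only [Units.val_one, Int.cast_one, one_smul, Units.val_neg, Int.cast_neg, neg_smul,
      ← sub_eq_add_neg, pow_succ (2 : ℝ) N]
    linear_combination (2 : ℝ) ^ N * hpar

/-- Khintchine-type bound for the norm of a Rademacher sum. -/
lemma sum_signs_norm_le {V : Type*} [NormedAddCommGroup V] [InnerProductSpace ℝ V] {N : ℕ}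
    (w : Fin N → V) :
    ∑ ε : Fin N → ℤˣ, ‖∑ i, ((ε i : ℤ) : ℝ) • w i‖ ≤ 2 ^ N * Real.sqrt (∑ i, ‖w i‖ ^ 2) := by
  have h := sum_signs_norm_sq w 0
  simp only [zero_add, norm_zero, ne_eq, OfNat.ofNat_ne_zero, not_false_eq_true, zero_pow] at h
  have hcs := sq_sum_le_card_mul_sum_sq (s := (Finset.univ : Finset (Fin N → ℤˣ)))
    (f := fun ε => ‖∑ i, ((ε i : ℤ) : ℝ) • w i‖)
  rw [h, Finset.card_univ, Fintype.card_fun, Fintype.card_fin, Fintype.card_units_int] at hcs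
  refine le_of_sq_le_sq (hcs.trans_eq ?_) (by positivity)
  rw [mul_pow, Real.sq_sqrt (by positivity)]
  push_cast
  ring

lemma sum_signs_sum_mul {N : ℕ} (c : Fin N → ℝ) :
    ∑ ε : Fin N → ℤˣ, ∑ i, ((ε i : ℤ) : ℝ) * c i = 0 := by
  have h : ∑ ε : Fin N → ℤˣ, ∑ i, ((ε i : ℤ) : ℝ) * c i
      = -∑ ε : Fin N → ℤˣ, ∑ i, ((ε i : ℤ) : ℝ) * c i := by
    refine (Equiv.sum_comp (Equiv.neg (Fin N → ℤˣ))
      fun ε : Fin N → ℤˣ => ∑ i, ((ε i : ℤ) : ℝ) * c i).symm.trans ?_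
    conv_rhs => rw [← Finset.sum_neg_distrib]
    refine Finset.sum_congr rfl fun ε _ => ?_
    rw [← Finset.sum_neg_distrib]
    exact Finset.sum_congr rfl fun i _ => by simp
  linarith

variable {𝒳 : Type u} {K m n : ℕ}

lemma zero_mem_hypClass (net : Matrix (Fin m) (Fin n) ℝ → 𝒳 → Fin K → ℝ)
    (W₀ : Matrix (Fin m) (Fin n) ℝ) {B : ℝ} (hB : 0 ≤ B) (r : ℕ) :
    loraModel net W₀ (0 : Matrix (Fin m) (Fin r) ℝ) (0 : Matrix (Fin n) (Fin r) ℝ)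
      ∈ hypClass net W₀ B r :=
  ⟨0, 0, by simpa using hB, rfl⟩

/-- With `p = m + n`, the differences are `(r - 1)(p - r - 1)` and `r (p - 2r)`. -/
lemma rank_dim_bounds {m n r : ℕ} (hr : 1 ≤ r) (hrm : 2 * r ≤ m + n) :
    ((m : ℝ) + n - 1 ≤ (r : ℝ) * ((m : ℝ) + n) - (r : ℝ) ^ 2) ∧
      (r : ℝ) * ((m : ℝ) + n) ≤ 2 * ((r : ℝ) * ((m : ℝ) + n) - (r : ℝ) ^ 2) := by
  have h1 : (1 : ℝ) ≤ r := by exact_mod_cast hr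
  have h2 : 2 * (r : ℝ) ≤ m + n := by exact_mod_cast hrm
  constructor <;> nlinarith

/-- Rademacher complexity of one output coordinate of the low-rank class. -/
theorem empRademacher_hypClass_le {N : ℕ} (net : Matrix (Fin m) (Fin n) ℝ → 𝒳 → Fin K → ℝ)
    (W₀ : Matrix (Fin m) (Fin n) ℝ) {B : ℝ} (hB : 0 ≤ B) (hm : 1 ≤ m) (hN : 1 ≤ N) {r : ℕ}
    (hr : 1 ≤ r) (hrm : 2 * r ≤ m + n) (x : Fin N → 𝒳) (j : Fin K) {M : ℝ}
    (hM : ∀ i, specNorm (jac net W₀ (x i) j) ≤ M) :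
    empRademacher ((fun (f : 𝒳 → Fin K → ℝ) (y : 𝒳) => f y j) '' hypClass net W₀ B r) x
      ≤ M * varTerm m n N B r := by
  have hN' : (0 : ℝ) < N := by exact_mod_cast hN
  have hM0 : 0 ≤ M := (specNorm_nonneg _).trans (hM ⟨0, hN⟩)
  let w : Fin N → EuclideanSpace ℝ (Fin m × Fin n) := fun i => matrixToVec (jac net W₀ (x i) j)
  have hsup : ∀ ε : Fin N → ℤˣ,
      sSup ((fun f : 𝒳 → ℝ => (1 / (N : ℝ)) * ∑ i, ((ε i : ℤ) : ℝ) * f (x i)) ''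
        ((fun (f : 𝒳 → Fin K → ℝ) (y : 𝒳) => f y j) '' hypClass net W₀ B r))
      ≤ (1 / (N : ℝ)) * (∑ i, ((ε i : ℤ) : ℝ) * net W₀ (x i) j
          + B * ‖∑ i, ((ε i : ℤ) : ℝ) • w i‖) := by
    intro ε
    refine csSup_le (((Set.nonempty_of_mem (zero_mem_hypClass net W₀ hB r)).image _).image _) ?_
    rintro _ ⟨_, ⟨_, ⟨u, v, huv, rfl⟩, rfl⟩, rfl⟩
    simp only [loraModel, linModel, mul_add, Finset.sum_add_distrib]
    refine add_le_add_right ?_ _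
    refine mul_le_mul_of_nonneg_left ?_ (by positivity)
    have h1 : ∑ i, ((ε i : ℤ) : ℝ) * frobInner (jac net W₀ (x i) j) (u * v.transpose)
        = inner ℝ (matrixToVec (u * v.transpose)) (∑ i, ((ε i : ℤ) : ℝ) • w i) := by
      simp only [inner_sum, inner_smul_right, frobInner_eq_inner, w]
    rw [h1]
    refine (real_inner_le_norm _ _).trans (mul_le_mul_of_nonneg_right ?_ (norm_nonneg _))
    rw [norm_matrixToVec]
    exact (frobNorm_mul_transpose_le u v).trans huv
  have hw : ∑ i, ‖w i‖ ^ 2 ≤ N * (n * M ^ 2) := by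
    calc _ ≤ ∑ _i : Fin N, (n : ℝ) * M ^ 2 := by
          refine Finset.sum_le_sum fun i _ => ?_
          rw [norm_matrixToVec]
          refine (frobNorm_sq_le_specNorm_sq _).trans ?_
          exact mul_le_mul_of_nonneg_left (pow_le_pow_left₀ (specNorm_nonneg _) (hM i) 2)
            (Nat.cast_nonneg _)
      _ = _ := by simp
  -- The Frobenius argument yields the rank-free factor `√n`, which the variance term already
  -- dominates at rank one.
  have hn : (n : ℝ) ≤ (r : ℝ) * ((m : ℝ) + n) - (r : ℝ) ^ 2 := by
    have h1 := (rank_dim_bounds hr hrm).1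
    have h2 : (1 : ℝ) ≤ m := by exact_mod_cast hm
    linarith
  rw [empRademacher, div_le_iff₀ (by positivity)]
  refine (Finset.sum_le_sum fun ε _ => hsup ε).trans ?_
  rw [← Finset.mul_sum, Finset.sum_add_distrib, sum_signs_sum_mul, zero_add, ← Finset.mul_sum]
  calc _ ≤ 1 / (N : ℝ) * (B * (2 ^ N * Real.sqrt
          (N * (((r : ℝ) * ((m : ℝ) + n) - (r : ℝ) ^ 2) * M ^ 2)))) := by
        gcongr
        refine (sum_signs_norm_le w).trans ?_
        gcongr
        exact hw.trans (by gcongr)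
    _ = _ := by
        have h3 : (N : ℝ) * (((r : ℝ) * ((m : ℝ) + n) - (r : ℝ) ^ 2) * M ^ 2) =
            (N * M) ^ 2 * (((r : ℝ) * ((m : ℝ) + n) - (r : ℝ) ^ 2) / N) := by
          field_simp
        rw [h3, Real.sqrt_mul (sq_nonneg _), Real.sqrt_sq (by positivity), varTerm]
        field_simp

end Rademacher

/-! ### From factor pairs to the risk of trained models. -/

section Generalization

variable {𝒳 : Type u} {K m n r : ℕ}

/-- Telescoping `u vᵀ - u' v'ᵀ = (u - u') vᵀ + u' (v - v')ᵀ`, followed by spectral duality on each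
term. -/
lemma abs_loraModel_sub_le (net : Matrix (Fin m) (Fin n) ℝ → 𝒳 → Fin K → ℝ)
    (W₀ : Matrix (Fin m) (Fin n) ℝ) (u u' : Matrix (Fin m) (Fin r) ℝ)
    (v v' : Matrix (Fin n) (Fin r) ℝ) (x : 𝒳) (j : Fin K) :
    |loraModel net W₀ u v x j - loraModel net W₀ u' v' x j| ≤ specNorm (jac net W₀ x j) *
      (frobNorm (u - u') * frobNorm v + frobNorm u' * frobNorm (v - v')) := by
  have h : loraModel net W₀ u v x j - loraModel net W₀ u' v' x j =
      frobInner (jac net W₀ x j) ((u - u') * v.transpose) +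
        frobInner (jac net W₀ x j) (u' * (v - v').transpose) := by
    rw [← frobInner_add, Matrix.transpose_sub, Matrix.sub_mul, Matrix.mul_sub, sub_add_sub_cancel,
      frobInner_sub]
    simp [loraModel, linModel]
  rw [h, mul_add]
  exact (abs_add_le _ _).trans (add_le_add (abs_frobInner_mul_transpose_le _ _ _)
    (abs_frobInner_mul_transpose_le _ _ _))

/-- The space of pairs of factors, normalized and with independent entries. -/
abbrev FactorSpace (m n r : ℕ) : Type :=
  EuclideanSpace ℝ (Fin m × Fin r) × EuclideanSpace ℝ (Fin n × Fin r)

lemma finrank_factorSpace : Module.finrank ℝ (FactorSpace m n r) = r * (m + n) := by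
  simp [FactorSpace, Module.finrank_prod]
  ring

/-- Excess loss, over the pretrained network, of the pair of factors `√B θ`. -/
noncomputable def lossGap (net : Matrix (Fin m) (Fin n) ℝ → 𝒳 → Fin K → ℝ) (W₀ : Matrix (Fin m) (Fin n) ℝ)
    (B : ℝ) (θ : FactorSpace m n r) (z : 𝒳 × (Fin K → ℝ)) : ℝ :=
  ceLoss (loraModel net W₀ (Real.sqrt B • vecToMatrix θ.1) (Real.sqrt B • vecToMatrix θ.2) z.1) z.2
    - ceLoss (net W₀ z.1) z.2

lemma lossGap_zero (net : Matrix (Fin m) (Fin n) ℝ → 𝒳 → Fin K → ℝ) (W₀ : Matrix (Fin m) (Fin n) ℝ)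
    (B : ℝ) (z : 𝒳 × (Fin K → ℝ)) : lossGap net W₀ B (0 : FactorSpace m n r) z = 0 := by
  have h : loraModel net W₀ (Real.sqrt B • vecToMatrix (0 : FactorSpace m n r).1)
      (Real.sqrt B • vecToMatrix (0 : FactorSpace m n r).2) z.1 = net W₀ z.1 := by
    ext j
    simp [loraModel, linModel, frobInner]
  rw [lossGap, h, sub_self]

lemma abs_lossGap_sub_le (net : Matrix (Fin m) (Fin n) ℝ → 𝒳 → Fin K → ℝ)
    (W₀ : Matrix (Fin m) (Fin n) ℝ) {B R : ℝ} (hB : 0 ≤ B) (hR : 0 ≤ R) {z : 𝒳 × (Fin K → ℝ)}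
    (hz : z.2 ∈ stdSimplex ℝ (Fin K)) (hG : ∀ j, specNorm (jac net W₀ z.1 j) ≤ R)
    {θ θ' : FactorSpace m n r} (hθ : ‖θ‖ ≤ 4) (hθ' : ‖θ'‖ ≤ 4) :
    |lossGap net W₀ B θ z - lossGap net W₀ B θ' z| ≤ 16 * (R * B) * ‖θ - θ'‖ := by
  have h1 : ‖θ.2‖ ≤ 4 := (norm_snd_le θ).trans hθ
  have h2 : ‖θ'.1‖ ≤ 4 := (norm_fst_le θ').trans hθ'
  have h3 : ‖θ.1 - θ'.1‖ ≤ ‖θ - θ'‖ := norm_fst_le (θ - θ')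
  have h4 : ‖θ.2 - θ'.2‖ ≤ ‖θ - θ'‖ := norm_snd_le (θ - θ')
  -- The constant is `16 = 2 · (4 + 4)`: the loss contributes `2`, each factor its radius `4`, which
  -- is the bound on chain points.
  rw [lossGap, lossGap, sub_sub_sub_cancel_right,
    show 16 * (R * B) * ‖θ - θ'‖ = 2 * (R * (B * (‖θ - θ'‖ * 4 + 4 * ‖θ - θ'‖))) by ring]
  refine abs_ceLoss_sub_le hz fun j => (abs_loraModel_sub_le _ _ _ _ _ _ _ _).trans ?_
  refine mul_le_mul (hG j) ?_ ?_ hR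
  · simp only [← smul_sub, frobNorm_smul, ← vecToMatrix_sub, frobNorm_vecToMatrix,
      abs_of_nonneg (Real.sqrt_nonneg B)]
    calc _ = Real.sqrt B ^ 2 * (‖θ.1 - θ'.1‖ * ‖θ.2‖ + ‖θ'.1‖ * ‖θ.2 - θ'.2‖) := by ring
      _ ≤ _ := by
        rw [Real.sq_sqrt hB]
        gcongr
  · exact add_nonneg (mul_nonneg (frobNorm_nonneg _) (frobNorm_nonneg _))
      (mul_nonneg (frobNorm_nonneg _) (frobNorm_nonneg _))

/-- Every product of two factors within the norm budget has balanced factors. -/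
lemma exists_balanced_factors {B : ℝ} (hB : 0 < B) {u : Matrix (Fin m) (Fin r) ℝ}
    {v : Matrix (Fin n) (Fin r) ℝ} (huv : frobNorm u * frobNorm v ≤ B) :
    ∃ θ : FactorSpace m n r, ‖θ‖ ≤ 1 ∧
      (Real.sqrt B • vecToMatrix θ.1) * (Real.sqrt B • vecToMatrix θ.2).transpose
        = u * v.transpose := by
  have hB' : 0 < Real.sqrt B := Real.sqrt_pos.2 hB
  have hzero : (Real.sqrt B • vecToMatrix (0 : FactorSpace m n r).1) *
      (Real.sqrt B • vecToMatrix (0 : FactorSpace m n r).2).transpose = 0 := by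
    simp
  rcases (frobNorm_nonneg u).eq_or_lt with hu | hu
  · refine ⟨0, by simp, ?_⟩
    rw [hzero, eq_zero_of_frobNorm_eq_zero hu.symm, Matrix.zero_mul]
  rcases (frobNorm_nonneg v).eq_or_lt with hv | hv
  · refine ⟨0, by simp, ?_⟩
    rw [hzero, eq_zero_of_frobNorm_eq_zero hv.symm, Matrix.transpose_zero, Matrix.mul_zero]
  set α := Real.sqrt (frobNorm u) with hα
  set β := Real.sqrt (frobNorm v) with hβ
  have hα0 : 0 < α := Real.sqrt_pos.2 hu
  have hβ0 : 0 < β := Real.sqrt_pos.2 hv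
  have hα2 : frobNorm u = α ^ 2 := (Real.sq_sqrt hu.le).symm
  have hβ2 : frobNorm v = β ^ 2 := (Real.sq_sqrt hv.le).symm
  have hαβ : α * β ≤ Real.sqrt B := by
    refine Real.le_sqrt_of_sq_le ?_
    rw [mul_pow, ← hα2, ← hβ2]
    exact huv
  -- Balancing gives both factors the norm `α β = √(‖u‖ ‖v‖) ≤ √B`. The norm of the pair is the
  -- maximum of the two.
  refine ⟨(matrixToVec ((β / α / Real.sqrt B) • u), matrixToVec ((α / β / Real.sqrt B) • v)), ?_, ?_⟩
  · rw [norm_prod_le_iff]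
    simp only [norm_matrixToVec, frobNorm_smul, hα2, hβ2]
    rw [abs_of_pos (by positivity), abs_of_pos (by positivity)]
    constructor
    · rw [show β / α / Real.sqrt B * α ^ 2 = α * β / Real.sqrt B by field_simp]
      exact div_le_one_of_le₀ hαβ hB'.le
    · rw [show α / β / Real.sqrt B * β ^ 2 = α * β / Real.sqrt B by field_simp]
      exact div_le_one_of_le₀ hαβ hB'.le
  · simp only [vecToMatrix_matrixToVec, smul_smul, Matrix.transpose_smul, Matrix.smul_mul,
      Matrix.mul_smul]
    rw [show Real.sqrt B * (α / β / Real.sqrt B) * (Real.sqrt B * (β / α / Real.sqrt B)) = 1 by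
      field_simp, one_smul]

/-- A trained pair of factors minimizes the loss within the norm budget. -/
lemma IsTrained.le_of_budget {L : Matrix (Fin m) (Fin r) ℝ → Matrix (Fin n) (Fin r) ℝ → ℝ} {B : ℝ}
    {u : Matrix (Fin m) (Fin r) ℝ} {v : Matrix (Fin n) (Fin r) ℝ} (h : IsTrained L B u v)
    (hL : ∀ u v, 0 ≤ L u v) (u' : Matrix (Fin m) (Fin r) ℝ) (v' : Matrix (Fin n) (Fin r) ℝ)
    (h' : frobNorm u' * frobNorm v' ≤ B) : L u v ≤ L u' v' := by
  rcases h.2 with hmin | ⟨u₀, v₀, ⟨μ, hμ, hPL⟩, hlevel, hS⟩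
  · exact hmin u' v' h'
  have hgrad : gradSq L u v = 0 := by
    have h1 : ∀ a k, deriv (fun t : ℝ => L (u + t • Matrix.single a k 1) v) 0 = 0 := fun a k => by
      simpa using (hS (Matrix.single a k 1) 0).1
    have h2 : ∀ b k, deriv (fun t : ℝ => L u (v + t • Matrix.single b k 1)) 0 = 0 := fun b k => by
      simpa using (hS 0 (Matrix.single b k 1)).1
    simp only [gradSq, h1, h2]
    simp
  have hle := hPL u v hlevel
  rw [hgrad, mul_zero] at hle
  -- With zero gradient, the inequality leaves no excess over the infimum, which is a genuine one
  -- because `L` is bounded below by `0`.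
  have hinf : L u v ≤ ⨅ p : Matrix (Fin m) (Fin r) ℝ × Matrix (Fin n) (Fin r) ℝ, L p.1 p.2 := by
    by_contra! hlt
    have := mul_pos hμ (sub_pos.2 hlt)
    linarith
  exact hinf.trans (ciInf_le ⟨0, by rintro _ ⟨p, rfl⟩; exact hL _ _⟩ (u', v'))

lemma empRisk_nonneg (net : Matrix (Fin m) (Fin n) ℝ → 𝒳 → Fin K → ℝ)
    (W₀ : Matrix (Fin m) (Fin n) ℝ) {N : ℕ} {S : Fin N → 𝒳 × (Fin K → ℝ)}
    (hS : ∀ i, (S i).2 ∈ stdSimplex ℝ (Fin K)) (u : Matrix (Fin m) (Fin r) ℝ)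
    (v : Matrix (Fin n) (Fin r) ℝ) : 0 ≤ empRisk net W₀ S u v :=
  mul_nonneg (by positivity) (Finset.sum_nonneg fun i _ => ceLoss_nonneg (hS i) _)

variable [MeasurableSpace 𝒳]

/-- A partial derivative is a pointwise limit of difference quotients along `1 / (k + 1)`, each
measurable in the input. -/
lemma measurable_jac_apply {net : Matrix (Fin m) (Fin n) ℝ → 𝒳 → Fin K → ℝ}
    {W₀ : Matrix (Fin m) (Fin n) ℝ} (hnet : ∀ W, Measurable (net W))
    (hdiff : ∀ x, DifferentiableAt ℝ (fun W => net W x) W₀) (j : Fin K) (a : Fin m) (b : Fin n) :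
    Measurable fun x => jac net W₀ x j a b := by
  let t : ℕ → ℝ := fun k => 1 / ((k : ℝ) + 1)
  have ht : Filter.Tendsto t Filter.atTop (nhdsWithin 0 {0}ᶜ) := by
    refine tendsto_nhdsWithin_iff.2 ⟨tendsto_one_div_add_atTop_nhds_zero_nat, ?_⟩
    exact Filter.Eventually.of_forall fun k => (by positivity : (0 : ℝ) < t k).ne'
  refine measurable_of_tendsto_metrizable (f := fun (k : ℕ) x =>
    (t k)⁻¹ * (net (W₀ + (0 + t k) • Matrix.single a b 1) x j
      - net (W₀ + (0 : ℝ) • Matrix.single a b 1) x j)) (fun k => ?_) ?_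
  · exact (((measurable_pi_apply j).comp (hnet _)).sub
      ((measurable_pi_apply j).comp (hnet _))).const_mul _
  · rw [tendsto_pi_nhds]
    intro x
    have hd : DifferentiableAt ℝ (fun s : ℝ => net (W₀ + s • Matrix.single a b 1) x j) 0 := by
      let : NormedAddCommGroup (Matrix (Fin m) (Fin n) ℝ) := Matrix.normedAddCommGroup
      let : NormedSpace ℝ (Matrix (Fin m) (Fin n) ℝ) := Matrix.normedSpace
      have h1 : DifferentiableAt ℝ (fun s : ℝ => W₀ + s • Matrix.single a b (1 : ℝ)) 0 :=
        (differentiableAt_const _).add (differentiableAt_id.smul_const _)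
      have h2 : DifferentiableAt ℝ (fun W => net W x) (W₀ + (0 : ℝ) • Matrix.single a b (1 : ℝ)) := by
        rw [zero_smul, add_zero]
        exact hdiff x
      exact differentiableAt_pi.1 (h2.comp (0 : ℝ) h1) j
    exact hd.hasDerivAt.tendsto_slope_zero.comp ht

lemma measurable_loraModel {net : Matrix (Fin m) (Fin n) ℝ → 𝒳 → Fin K → ℝ}
    {W₀ : Matrix (Fin m) (Fin n) ℝ} (hnet : ∀ W, Measurable (net W))
    (hdiff : ∀ x, DifferentiableAt ℝ (fun W => net W x) W₀) (u : Matrix (Fin m) (Fin r) ℝ)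
    (v : Matrix (Fin n) (Fin r) ℝ) : Measurable (loraModel net W₀ u v) := by
  refine measurable_pi_lambda _ fun j => ?_
  simp only [loraModel, linModel, frobInner_eq_sum]
  refine ((measurable_pi_apply j).comp (hnet W₀)).add ?_
  exact Finset.measurable_sum _ fun a _ => Finset.measurable_sum _ fun b _ =>
    (measurable_jac_apply hnet hdiff j a b).mul_const _

lemma measurable_ceLoss_comp {f : 𝒳 → Fin K → ℝ} (hf : Measurable f) :
    Measurable fun z : 𝒳 × (Fin K → ℝ) => ceLoss (f z.1) z.2 := by
  have hfj : ∀ j, Measurable fun z : 𝒳 × (Fin K → ℝ) => f z.1 j := fun j =>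
    (measurable_pi_apply j).comp (hf.comp measurable_fst)
  have hy : ∀ j, Measurable fun z : 𝒳 × (Fin K → ℝ) => z.2 j := fun j =>
    (measurable_pi_apply j).comp measurable_snd
  refine (Finset.measurable_sum _ fun j _ => (hy j).mul (Real.measurable_log.comp ?_)).neg
  exact ((hfj j).exp).div (Finset.measurable_sum _ fun k _ => (hfj k).exp)

lemma measurable_lossGap {net : Matrix (Fin m) (Fin n) ℝ → 𝒳 → Fin K → ℝ}
    {W₀ : Matrix (Fin m) (Fin n) ℝ} (hnet : ∀ W, Measurable (net W))
    (hdiff : ∀ x, DifferentiableAt ℝ (fun W => net W x) W₀) (B : ℝ) (θ : FactorSpace m n r) :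
    Measurable (lossGap net W₀ B θ) :=
  (measurable_ceLoss_comp (measurable_loraModel hnet hdiff _ _)).sub
    (measurable_ceLoss_comp (hnet W₀))

lemma risk_nonneg {P : Measure (𝒳 × (Fin K → ℝ))} (hY : ∀ᵐ z ∂P, z.2 ∈ stdSimplex ℝ (Fin K))
    (f : 𝒳 → Fin K → ℝ) : 0 ≤ risk P f :=
  integral_nonneg_of_ae (hY.mono fun _ hz => ceLoss_nonneg hz _)

lemma bddBelow_risk_image {P : Measure (𝒳 × (Fin K → ℝ))}
    (hY : ∀ᵐ z ∂P, z.2 ∈ stdSimplex ℝ (Fin K)) (F : Set (𝒳 → Fin K → ℝ)) :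
    BddBelow (risk P '' F) :=
  ⟨0, by rintro _ ⟨f, -, rfl⟩; exact risk_nonneg hY f⟩

section Setting

variable {net : Matrix (Fin m) (Fin n) ℝ → 𝒳 → Fin K → ℝ} {W₀ : Matrix (Fin m) (Fin n) ℝ}
  {P : Measure (𝒳 × (Fin K → ℝ))} [IsProbabilityMeasure P] {B R : ℝ}

lemma integrable_lossGap (hB : 0 ≤ B) (hR : 0 ≤ R) (hnet : ∀ W, Measurable (net W))
    (hdiff : ∀ x, DifferentiableAt ℝ (fun W => net W x) W₀)
    (hY : ∀ᵐ z ∂P, z.2 ∈ stdSimplex ℝ (Fin K))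
    (hG : ∀ᵐ z ∂P, ∀ j, specNorm (jac net W₀ z.1 j) ≤ R) {θ : FactorSpace m n r} (hθ : ‖θ‖ ≤ 1) :
    Integrable (lossGap net W₀ B θ) P ∧ |∫ z, lossGap net W₀ B θ z ∂P| ≤ 16 * (R * B) := by
  have hbound : ∀ᵐ z ∂P, ‖lossGap net W₀ B θ z‖ ≤ 16 * (R * B) := by
    filter_upwards [hY, hG] with z hz hGz
    have h := abs_lossGap_sub_le net W₀ hB hR hz hGz (θ := θ) (θ' := 0) (by linarith) (by simp)
    rw [lossGap_zero, sub_zero, sub_zero] at h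
    exact h.trans (mul_le_of_le_one_right (by positivity) hθ)
  refine ⟨Integrable.of_bound (measurable_lossGap hnet hdiff B θ).aestronglyMeasurable _ hbound, ?_⟩
  simpa using norm_integral_le_of_norm_le_const hbound

/-- Representation of the risk and the empirical risk through the balanced factors. -/
lemma exists_factorSpace_rep (hB : 0 < B) (hR : 0 ≤ R) (hnet : ∀ W, Measurable (net W))
    (hdiff : ∀ x, DifferentiableAt ℝ (fun W => net W x) W₀)
    (hY : ∀ᵐ z ∂P, z.2 ∈ stdSimplex ℝ (Fin K))
    (hint : Integrable (fun z => ceLoss (net W₀ z.1) z.2) P)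
    (hG : ∀ᵐ z ∂P, ∀ j, specNorm (jac net W₀ z.1 j) ≤ R) {u : Matrix (Fin m) (Fin r) ℝ}
    {v : Matrix (Fin n) (Fin r) ℝ} (huv : frobNorm u * frobNorm v ≤ B) :
    ∃ θ : FactorSpace m n r, ‖θ‖ ≤ 1 ∧
      risk P (loraModel net W₀ u v) = risk P (net W₀) + ∫ z, lossGap net W₀ B θ z ∂P ∧
      ∀ (N : ℕ) (S : Fin N → 𝒳 × (Fin K → ℝ)), empRisk net W₀ S u v =
        (1 / (N : ℝ)) * ∑ i, ceLoss (net W₀ (S i).1) (S i).2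
          + (∑ i, lossGap net W₀ B θ (S i)) / N := by
  obtain ⟨θ, hθ, hprod⟩ := exists_balanced_factors hB huv
  have hmodel : loraModel net W₀ (Real.sqrt B • vecToMatrix θ.1) (Real.sqrt B • vecToMatrix θ.2)
      = loraModel net W₀ u v := by
    simp only [loraModel, hprod]
  have hloss : ∀ z : 𝒳 × (Fin K → ℝ), ceLoss (loraModel net W₀ u v z.1) z.2
      = ceLoss (net W₀ z.1) z.2 + lossGap net W₀ B θ z := fun z => by
    rw [lossGap, hmodel, add_sub_cancel]
  refine ⟨θ, hθ, ?_, fun N S => ?_⟩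
  · simp only [risk, hloss]
    exact integral_add hint (integrable_lossGap hB.le hR hnet hdiff hY hG hθ).1
  · simp only [empRisk, hloss, Finset.sum_add_distrib]
    ring

/-- Risk of trained models, with high probability, in terms of the parameter dimension. -/
lemma measure_pi_trained_risk_gt_le {N : ℕ} (hN : 1 ≤ N) (hm : 1 ≤ m) (hr : 1 ≤ r) (hB : 0 < B)
    (hR : 0 ≤ R) (hnet : ∀ W, Measurable (net W))
    (hdiff : ∀ x, DifferentiableAt ℝ (fun W => net W x) W₀)
    (hY : ∀ᵐ z ∂P, z.2 ∈ stdSimplex ℝ (Fin K))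
    (hint : Integrable (fun z => ceLoss (net W₀ z.1) z.2) P)
    (hG : ∀ᵐ z ∂P, ∀ j, specNorm (jac net W₀ z.1 j) ≤ R) {δ : ℝ} (hδ : 0 < δ) (hδ1 : δ ≤ 1) :
    (Measure.pi fun _ : Fin N => P)
      {S | ∃ (u : Matrix (Fin m) (Fin r) ℝ) (v : Matrix (Fin n) (Fin r) ℝ),
        IsTrained (empRisk net W₀ S) B u v ∧
          bias P net W₀ B r + 256 * (R * B) *
              Real.sqrt (2 * (3 * ((r : ℝ) * ((m : ℝ) + n)) + Real.log (2 / δ)) / N)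
            < risk P (loraModel net W₀ u v)} ≤ ENNReal.ofReal δ := by
  have hfr := finrank_factorSpace (m := m) (n := n) (r := r)
  have hchain := measure_pi_exists_empDev_gt_le (E := FactorSpace m n r) P hN
    (by rw [hfr]; exact Nat.mul_pos hr (by omega))
    (fun θ => (measurable_lossGap hnet hdiff B θ).aemeasurable)
    (lossGap_zero net W₀ B) (L := 16 * (R * B)) (by positivity)
    (by
      filter_upwards [hY, hG] with z hz hGz θ θ' hθ hθ'
      exact abs_lossGap_sub_le net W₀ hB.le hR hz hGz hθ hθ') hδ hδ1
  rw [hfr] at hchain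
  push_cast at hchain
  have hYS : ∀ᵐ S ∂(Measure.pi fun _ : Fin N => P), ∀ i, (S i).2 ∈ stdSimplex ℝ (Fin K) :=
    ae_all_iff.2 fun i =>
      (measurePreserving_eval (fun _ : Fin N => P) i).quasiMeasurePreserving.ae hY
  refine (measure_mono_ae ?_).trans hchain
  filter_upwards [hYS] with S hS hmem
  obtain ⟨u, v, htr, hlt⟩ := hmem
  by_contra hnot
  set W := 8 * (16 * (R * B)) *
    Real.sqrt (2 * (3 * ((r : ℝ) * ((m : ℝ) + n)) + Real.log (2 / δ)) / N) with hW
  have hdev : ∀ θ : FactorSpace m n r, ‖θ‖ ≤ 1 → |empDev P (lossGap net W₀ B θ) S| ≤ W := by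
    intro θ hθ
    by_contra! h
    exact hnot ⟨θ, by linarith, h⟩
  refine absurd hlt (not_lt.2 ?_)
  rw [← sub_le_iff_le_add]
  -- Against any competitor: risk to empirical risk, minimality, and back to risk, with two
  -- deviations `W`. Hence `256 = 2 · 8 · 16`; the empirical loss of the pretrained network cancels.
  refine le_csInf ((Set.nonempty_of_mem (zero_mem_hypClass net W₀ hB.le r)).image _) ?_
  rintro _ ⟨_, ⟨u', v', huv', rfl⟩, rfl⟩
  have herm := htr.le_of_budget (empRisk_nonneg net W₀ hS) u' v' huv'
  obtain ⟨θ, hθ, hr1, he1⟩ := exists_factorSpace_rep hB hR hnet hdiff hY hint hG htr.1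
  obtain ⟨θ', hθ', hr2, he2⟩ := exists_factorSpace_rep hB hR hnet hdiff hY hint hG huv'
  rw [he1, he2] at herm
  have hd1 := abs_le.1 (hdev θ hθ)
  have hd2 := abs_le.1 (hdev θ' hθ')
  rw [empDev] at hd1 hd2
  rw [hr1, hr2]
  linarith [hd1.1, hd2.2]

lemma complexity_le {N : ℕ} (hN : 1 ≤ N) (hr : 1 ≤ r) (hrm : 2 * r ≤ m + n) (hB : 0 ≤ B)
    (hR : 0 ≤ R) {t : ℝ} (ht : 0 ≤ t) :
    256 * (R * B) * Real.sqrt (2 * (3 * ((r : ℝ) * ((m : ℝ) + n)) + t) / N)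
      ≤ 896 * R * varTerm m n N B r + 384 * (R * B) * Real.sqrt (t / N) := by
  have hN' : (0 : ℝ) < N := by exact_mod_cast hN
  have hD := (rank_dim_bounds hr hrm).2
  set D : ℝ := (r : ℝ) * ((m : ℝ) + n) - (r : ℝ) ^ 2 with hDdef
  have hD0 : 0 ≤ D := by
    have : (0 : ℝ) ≤ (r : ℝ) * ((m : ℝ) + n) := by positivity
    linarith
  -- The radicand is at most `12 D/N + 2 t/N`, and `3.5² ≥ 12`, `1.5² ≥ 2`.
  have h1 : Real.sqrt (2 * (3 * ((r : ℝ) * ((m : ℝ) + n)) + t) / N)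
      ≤ 3.5 * Real.sqrt (D / N) + 1.5 * Real.sqrt (t / N) := by
    rw [Real.sqrt_le_left (by positivity)]
    have h2 := Real.sq_sqrt (show 0 ≤ D / N by positivity)
    have h3 := Real.sq_sqrt (show 0 ≤ t / N by positivity)
    have h4 : 2 * (3 * ((r : ℝ) * ((m : ℝ) + n)) + t) / N ≤ 12 * (D / N) + 2 * (t / N) := by
      rw [← mul_div_assoc, ← mul_div_assoc, ← add_div]
      gcongr
      linarith
    have h5 : 0 ≤ Real.sqrt (D / N) * Real.sqrt (t / N) := by positivity
    have h6 : 0 ≤ D / N := by positivity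
    have h7 : 0 ≤ t / N := by positivity
    nlinarith
  calc _ ≤ 256 * (R * B) * (3.5 * Real.sqrt (D / N) + 1.5 * Real.sqrt (t / N)) := by gcongr
    _ = _ := by rw [varTerm]; ring

lemma sqrt_inv_le_varTerm {N : ℕ} (hm : 1 ≤ m) (hn : 1 ≤ n) (hr : 1 ≤ r) (hrm : 2 * r ≤ m + n)
    (hB : 0 ≤ B) : B * Real.sqrt (1 / N) ≤ varTerm m n N B r := by
  have h := (rank_dim_bounds hr hrm).1
  have h1 : (1 : ℝ) ≤ m := by exact_mod_cast hm
  have h2 : (1 : ℝ) ≤ n := by exact_mod_cast hn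
  rw [varTerm]
  gcongr
  linarith

lemma varTerm_nonneg {N : ℕ} (hB : 0 ≤ B) : 0 ≤ varTerm m n N B r :=
  mul_nonneg hB (Real.sqrt_nonneg _)

/-- Test risk of trained models, with high probability. -/
lemma measure_pi_trained_risk_gt_varTerm_le {N : ℕ} (hN : 1 ≤ N) (hm : 1 ≤ m) (hr : 1 ≤ r)
    (hrm : 2 * r ≤ m + n) (hB : 0 < B) (hR : 0 ≤ R) (hnet : ∀ W, Measurable (net W))
    (hdiff : ∀ x, DifferentiableAt ℝ (fun W => net W x) W₀)
    (hY : ∀ᵐ z ∂P, z.2 ∈ stdSimplex ℝ (Fin K))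
    (hint : Integrable (fun z => ceLoss (net W₀ z.1) z.2) P)
    (hG : ∀ᵐ z ∂P, ∀ j, specNorm (jac net W₀ z.1 j) ≤ R) {δ : ℝ} (hδ : 0 < δ) (hδ1 : δ ≤ 1) :
    (Measure.pi fun _ : Fin N => P)
      {S | ∃ (u : Matrix (Fin m) (Fin r) ℝ) (v : Matrix (Fin n) (Fin r) ℝ),
        IsTrained (empRisk net W₀ S) B u v ∧
          bias P net W₀ B r + (896 * R * varTerm m n N B r
              + 384 * (R * B) * Real.sqrt (Real.log (2 / δ) / N))
            < risk P (loraModel net W₀ u v)} ≤ ENNReal.ofReal δ := by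
  refine (measure_mono ?_).trans
    (measure_pi_trained_risk_gt_le hN hm hr hB hR hnet hdiff hY hint hG hδ hδ1)
  rintro S ⟨u, v, htr, hlt⟩
  have hlog : 0 ≤ Real.log (2 / δ) := Real.log_nonneg (by rw [le_div_iff₀ hδ]; linarith)
  exact ⟨u, v, htr, lt_of_le_of_lt
    (add_le_add_right (complexity_le hN hr hrm hB.le hR hlog) _) hlt⟩

/-- Test risk of a trained model, in expectation over the sample. -/
theorem integral_trained_risk_le {N : ℕ} (hN : 1 ≤ N) (hm : 1 ≤ m) (hn : 1 ≤ n) (hr : 1 ≤ r)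
    (hrm : 2 * r ≤ m + n) (hB : 0 < B) (hR : 0 ≤ R) (hnet : ∀ W, Measurable (net W))
    (hdiff : ∀ x, DifferentiableAt ℝ (fun W => net W x) W₀)
    (hY : ∀ᵐ z ∂P, z.2 ∈ stdSimplex ℝ (Fin K))
    (hint : Integrable (fun z => ceLoss (net W₀ z.1) z.2) P)
    (hG : ∀ᵐ z ∂P, ∀ j, specNorm (jac net W₀ z.1 j) ≤ R)
    {u : (Fin N → 𝒳 × (Fin K → ℝ)) → Matrix (Fin m) (Fin r) ℝ}
    {v : (Fin N → 𝒳 × (Fin K → ℝ)) → Matrix (Fin n) (Fin r) ℝ}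
    (hmeas : AEStronglyMeasurable (fun S => risk P (loraModel net W₀ (u S) (v S)))
      (Measure.pi fun _ : Fin N => P))
    (htr : ∀ᵐ S ∂(Measure.pi fun _ : Fin N => P), IsTrained (empRisk net W₀ S) B (u S) (v S)) :
    Integrable (fun S => risk P (loraModel net W₀ (u S) (v S))) (Measure.pi fun _ : Fin N => P) ∧
      ∫ S, risk P (loraModel net W₀ (u S) (v S)) ∂(Measure.pi fun _ : Fin N => P)
        ≤ bias P net W₀ B r + 2000 * R * varTerm m n N B r := by
  have hI : Integrable (fun S => risk P (loraModel net W₀ (u S) (v S)))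
      (Measure.pi fun _ : Fin N => P) := by
    refine Integrable.of_bound hmeas (|risk P (net W₀)| + 16 * (R * B)) ?_
    filter_upwards [htr] with S hS
    obtain ⟨θ, hθ, hrep, -⟩ := exists_factorSpace_rep hB hR hnet hdiff hY hint hG hS.1
    rw [hrep]
    exact (abs_add_le _ _).trans
      (add_le_add_right (integrable_lossGap hB.le hR hnet hdiff hY hG hθ).2 _)
  refine ⟨hI, ?_⟩
  have h := integral_le_of_forall_measure_gt_le hI
    (a := bias P net W₀ B r + 896 * R * varTerm m n N B r)
    (b := 384 * (R * B) * Real.sqrt (1 / N)) (by positivity) (fun δ hδ hδ1 => by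
      refine (measure_mono_ae ?_).trans
        (measure_pi_trained_risk_gt_varTerm_le hN hm hr hrm hB hR hnet hdiff hY hint hG hδ hδ1.le)
      filter_upwards [htr] with S hS hlt
      refine ⟨u S, v S, hS, lt_of_eq_of_lt ?_ hlt⟩
      rw [show Real.log (2 / δ) / N = 1 / N * Real.log (2 / δ) by ring,
        Real.sqrt_mul (by positivity)]
      ring)
  -- The tail contributes `2 · 384` times a quantity below the variance term, and `896 + 768 ≤
  -- 2000`.
  have hv := mul_le_mul_of_nonneg_left (sqrt_inv_le_varTerm (N := N) hm hn hr hrm hB.le) hR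
  have hv0 := mul_nonneg hR (varTerm_nonneg (m := m) (n := n) (r := r) (N := N) hB.le)
  nlinarith

end Setting

end Generalization

/-! ### Monotonicity in the rank and the variance cost of leaving rank one. -/

section OptimalRank

variable {𝒳 : Type u} {K m n : ℕ}

/-- The radicands differ by `(s - r)(m + n - r - s) / N`, and `r + s < 2s ≤ m + n`. -/
lemma varTerm_lt_varTerm {N r s : ℕ} {B : ℝ} (hN : 1 ≤ N) (hB : 0 < B) (hr : 1 ≤ r) (hrs : r < s)
    (hs : 2 * s ≤ m + n) : varTerm m n N B r < varTerm m n N B s := by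
  have hN' : (0 : ℝ) < N := by exact_mod_cast hN
  have h1 : (r : ℝ) + 1 ≤ s := by exact_mod_cast hrs
  have h2 : 2 * (s : ℝ) ≤ m + n := by exact_mod_cast hs
  have h3 : (1 : ℝ) ≤ r := by exact_mod_cast hr
  have hpos : (0 : ℝ) ≤ (r : ℝ) * ((m : ℝ) + n) - (r : ℝ) ^ 2 := by nlinarith
  refine mul_lt_mul_of_pos_left (Real.sqrt_lt_sqrt (by positivity) ?_) hB
  refine (div_lt_div_iff_of_pos_right hN').2 ?_
  nlinarith

lemma varTerm_le_varTerm {N r s : ℕ} {B : ℝ} (hN : 1 ≤ N) (hB : 0 < B) (hr : 1 ≤ r) (hrs : r ≤ s)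
    (hs : 2 * s ≤ m + n) : varTerm m n N B r ≤ varTerm m n N B s := by
  rcases hrs.eq_or_lt with rfl | h
  exacts [le_rfl, (varTerm_lt_varTerm hN hB hr h hs).le]

/-- After squaring, AM-GM on the cross term leaves `47 p / 64 > 23 / 8`, which just holds at `p =
4`, the least `m + n` admitting rank two. -/
lemma sqrt_div_eight_lt {p : ℝ} (hp : 4 ≤ p) :
    Real.sqrt p / 8 + Real.sqrt (p - 1) < Real.sqrt (2 * p - 4) := by
  refine Real.lt_sqrt_of_sq_lt ?_
  have h1 := Real.sq_sqrt (show 0 ≤ p by linarith)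
  have h2 := Real.sq_sqrt (show 0 ≤ p - 1 by linarith)
  nlinarith [sq_nonneg (Real.sqrt p - Real.sqrt (p - 1))]

/-- The variance gap between rank one and any higher admissible rank. -/
lemma varTerm_gap {N r : ℕ} {B : ℝ} (hN : 1 ≤ N) (hB : 0 < B) (hr : 1 < r) (hrm : 2 * r ≤ m + n) :
    B * Real.sqrt (((m : ℝ) + n) / N) / 8 < varTerm m n N B r - varTerm m n N B 1 := by
  have hN' : (0 : ℝ) < N := by exact_mod_cast hN
  have h2 := varTerm_le_varTerm hN hB (by norm_num) hr hrm
  have hp : (4 : ℝ) ≤ (m : ℝ) + n := by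
    have : 4 ≤ m + n := by omega
    exact_mod_cast this
  have hsq : 0 < B / Real.sqrt N := div_pos hB (Real.sqrt_pos.2 hN')
  have key := mul_lt_mul_of_pos_left (sqrt_div_eight_lt hp) hsq
  have e1 : B * Real.sqrt (((m : ℝ) + n) / N) = B / Real.sqrt N * Real.sqrt ((m : ℝ) + n) := by
    rw [Real.sqrt_div' _ hN'.le]; ring
  have e2 : varTerm m n N B 1 = B / Real.sqrt N * Real.sqrt ((m : ℝ) + n - 1) := by
    rw [varTerm, Real.sqrt_div' _ hN'.le]
    norm_num
    ring
  have e3 : varTerm m n N B 2 = B / Real.sqrt N * Real.sqrt (2 * ((m : ℝ) + n) - 4) := by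
    rw [varTerm, Real.sqrt_div' _ hN'.le]
    norm_num
    ring
  have h2' : varTerm m n N B 2 ≤ varTerm m n N B r := h2
  rw [e1, e2]
  rw [e3] at h2'
  linarith

/-- Appending zero columns to both factors changes neither their norms nor their product. -/
lemma hypClass_mono (net : Matrix (Fin m) (Fin n) ℝ → 𝒳 → Fin K → ℝ) (W₀ : Matrix (Fin m) (Fin n) ℝ)
    (B : ℝ) {r s : ℕ} (hrs : r ≤ s) : hypClass net W₀ B r ⊆ hypClass net W₀ B s := by
  obtain ⟨t, rfl⟩ := Nat.exists_eq_add_of_le hrs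
  rintro _ ⟨u, v, huv, rfl⟩
  let pad : {a : ℕ} → Matrix (Fin a) (Fin r) ℝ → Matrix (Fin a) (Fin (r + t)) ℝ :=
    fun w => Matrix.of fun i => Fin.append (w i) 0
  have hnorm : ∀ {a : ℕ} (w : Matrix (Fin a) (Fin r) ℝ), frobNorm (pad w) = frobNorm w := by
    intro a w
    simp [frobNorm, pad, Fin.sum_univ_add]
  have hmul : pad u * (pad v).transpose = u * v.transpose := by
    ext i j
    simp [Matrix.mul_apply, pad, Fin.sum_univ_add]
  exact ⟨pad u, pad v, by rwa [hnorm, hnorm], by simp only [loraModel, hmul]⟩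

lemma bias_antitone [MeasurableSpace 𝒳] {P : Measure (𝒳 × (Fin K → ℝ))}
    (hY : ∀ᵐ z ∂P, z.2 ∈ stdSimplex ℝ (Fin K))
    (net : Matrix (Fin m) (Fin n) ℝ → 𝒳 → Fin K → ℝ) (W₀ : Matrix (Fin m) (Fin n) ℝ)
    {B : ℝ} (hB : 0 ≤ B) {r s : ℕ} (hrs : r ≤ s) : bias P net W₀ B s ≤ bias P net W₀ B r :=
  csInf_le_csInf (bddBelow_risk_image hY _)
    ((Set.nonempty_of_mem (zero_mem_hypClass net W₀ hB r)).image _)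
    (Set.image_mono (hypClass_mono net W₀ B hrs))

end OptimalRank

/-! ### Assembly, with `C = 2000`. -/

theorem mainTheorem3 :
    ∃ C : ℝ, 0 < C ∧
      ∀ (𝒳 : Type u) [MeasurableSpace 𝒳] (K m n N : ℕ)
        (net : Matrix (Fin m) (Fin n) ℝ → 𝒳 → Fin K → ℝ) (W₀ : Matrix (Fin m) (Fin n) ℝ)
        (P : Measure (𝒳 × (Fin K → ℝ))) [IsProbabilityMeasure P] (B R : ℝ),
        1 ≤ m → 1 ≤ n → 1 ≤ N → 0 < B → 0 ≤ R →
        (∀ W, Measurable (net W)) →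
        (∀ x, DifferentiableAt ℝ (fun W => net W x) W₀) →
        (∀ᵐ z ∂P, z.2 ∈ stdSimplex ℝ (Fin K)) →
        Integrable (fun z => ceLoss (net W₀ z.1) z.2) P →
        (∀ᵐ z ∂P, ∀ j, specNorm (jac net W₀ z.1 j) ≤ R) →
        -- Rademacher complexity of each output coordinate of the rank-`r` class
        (∀ (r : ℕ), 1 ≤ r → 2 * r ≤ m + n →
          ∀ (x : Fin N → 𝒳) (j : Fin K) (M : ℝ), (∀ i, specNorm (jac net W₀ (x i) j) ≤ M) →
            empRademacher ((fun (f : 𝒳 → Fin K → ℝ) (y : 𝒳) => f y j) '' hypClass net W₀ B r) x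
              ≤ M * varTerm m n N B r) ∧
        -- test risk of the trained model, in expectation over the sample
        (∀ (r : ℕ), 1 ≤ r → 2 * r ≤ m + n → ∀ c : ℝ, C * R ≤ c →
          ∀ (u : (Fin N → 𝒳 × (Fin K → ℝ)) → Matrix (Fin m) (Fin r) ℝ)
            (v : (Fin N → 𝒳 × (Fin K → ℝ)) → Matrix (Fin n) (Fin r) ℝ),
            AEStronglyMeasurable (fun S => risk P (loraModel net W₀ (u S) (v S)))
              (Measure.pi fun _ : Fin N => P) →
            (∀ᵐ S ∂(Measure.pi fun _ : Fin N => P), IsTrained (empRisk net W₀ S) B (u S) (v S)) →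
            Integrable (fun S => risk P (loraModel net W₀ (u S) (v S)))
                (Measure.pi fun _ : Fin N => P) ∧
              ∫ S, risk P (loraModel net W₀ (u S) (v S)) ∂(Measure.pi fun _ : Fin N => P)
                ≤ bias P net W₀ B r + c * varTerm m n N B r) ∧
        -- test risk of every trained model, with probability at least `1 - δ` over the sample
        (∀ (r : ℕ), 1 ≤ r → 2 * r ≤ m + n → ∀ c : ℝ, C * R ≤ c →
          ∀ δ : ℝ, 0 < δ → δ < 1 →
            (Measure.pi fun _ : Fin N => P)
              {S | ∃ (u : Matrix (Fin m) (Fin r) ℝ) (v : Matrix (Fin n) (Fin r) ℝ),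
                IsTrained (empRisk net W₀ S) B u v ∧
                  bias P net W₀ B r + c * varTerm m n N B r
                      + c * B * Real.sqrt (Real.log (2 / δ) / N)
                    < risk P (loraModel net W₀ u v)}
              ≤ ENNReal.ofReal δ) ∧
        -- the variance term is increasing in the rank, the bias is non-increasing
        (∀ r s : ℕ, 1 ≤ r → r < s → 2 * s ≤ m + n → varTerm m n N B r < varTerm m n N B s) ∧
        (∀ r s : ℕ, 1 ≤ r → r ≤ s → bias P net W₀ B s ≤ bias P net W₀ B r) ∧
        -- the optimal rank
        (∀ A c : ℝ, 0 < c → 8 * A ≤ c →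
          ((∀ r : ℕ, 1 < r → 2 * r ≤ m + n →
              bias P net W₀ B 1 - bias P net W₀ B r
                ≤ A * (B * Real.sqrt (((m : ℝ) + n) / N))) →
            ∀ r : ℕ, IsOptimalRank P net W₀ N B c r ↔ r = 1) ∧
          ∀ r : ℕ, IsOptimalRank P net W₀ N B c r → r ≠ 1 →
            A * (B * Real.sqrt (((m : ℝ) + n) / N))
                < bias P net W₀ B 1 - bias P net W₀ B r ∧
              c * (varTerm m n N B r - varTerm m n N B 1)
                ≤ bias P net W₀ B 1 - bias P net W₀ B r) := by
  refine ⟨2000, by norm_num, ?_⟩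
  intro 𝒳 _ K m n N net W₀ P _ B R hm hn hN hB hR hnet hdiff hY hint hG
  have hscale : ∀ c : ℝ, 2000 * R ≤ c → ∀ {k x : ℝ}, 0 ≤ k → k ≤ 2000 → 0 ≤ x →
      k * R * x ≤ c * x := by
    intro c hc k x hk hk' hx
    exact mul_le_mul_of_nonneg_right ((mul_le_mul_of_nonneg_right hk' hR).trans hc) hx
  have hgap : ∀ A c : ℝ, 0 < c → 8 * A ≤ c → ∀ r : ℕ, 1 < r → 2 * r ≤ m + n →
      A * (B * Real.sqrt (((m : ℝ) + n) / N)) < c * (varTerm m n N B r - varTerm m n N B 1) := by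
    intro A c hc hAc r hr hrm
    have h1 := mul_lt_mul_of_pos_left (varTerm_gap hN hB hr hrm) hc
    have h2 : 0 ≤ B * Real.sqrt (((m : ℝ) + n) / N) := by positivity
    have h3 := mul_le_mul_of_nonneg_right hAc h2
    linarith
  refine ⟨fun r hr hrm x j M hM => empRademacher_hypClass_le net W₀ hB.le hm hN hr hrm x j hM,
    fun r hr hrm c hc u v hmeas htr => ?_, fun r hr hrm c hc δ hδ hδ1 => ?_,
    fun r s hr hrs hs => varTerm_lt_varTerm hN hB hr hrs hs,
    fun r s _ hrs => bias_antitone hY net W₀ hB.le hrs,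
    fun A c hc hAc => ⟨fun hbias r => ⟨fun hopt => ?_, ?_⟩, fun r hopt hr1 => ?_⟩⟩
  · obtain ⟨h1, h2⟩ := integral_trained_risk_le hN hm hn hr hrm hB hR hnet hdiff hY hint hG hmeas htr
    refine ⟨h1, h2.trans (add_le_add_right ?_ _)⟩
    exact hscale c hc (by norm_num) le_rfl (varTerm_nonneg hB.le)
  · refine (measure_mono ?_).trans
      (measure_pi_trained_risk_gt_varTerm_le hN hm hr hrm hB hR hnet hdiff hY hint hG hδ hδ1.le)
    rintro S ⟨u, v, htr, hlt⟩
    refine ⟨u, v, htr, lt_of_le_of_lt ?_ hlt⟩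
    have h1 := hscale c hc (k := 896) (by norm_num) (by norm_num)
      (varTerm_nonneg (m := m) (n := n) (N := N) (r := r) hB.le)
    have h2 := hscale c hc (k := 384) (by norm_num) (by norm_num)
      (mul_nonneg hB.le (Real.sqrt_nonneg (Real.log (2 / δ) / N)))
    linarith
  · by_contra hr1
    have hr : 1 < r := lt_of_le_of_ne hopt.1 (Ne.symm hr1)
    have h1 := hopt.2.2 1 le_rfl (by omega)
    have h2 := hgap A c hc hAc r hr hopt.2.1
    have h3 := hbias r hr hopt.2.1
    rw [criterion, criterion] at h1
    linarith
  · rintro rfl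
    refine ⟨le_rfl, by omega, fun s hs hsm => ?_⟩
    rcases hs.eq_or_lt with rfl | hs'
    · exact le_rfl
    have h2 := hgap A c hc hAc s hs' hsm
    have h3 := hbias s hs' hsm
    rw [criterion, criterion]
    linarith
  · have hr : 1 < r := lt_of_le_of_ne hopt.1 (Ne.symm hr1)
    have h1 := hopt.2.2 1 le_rfl (by omega)
    have h2 := hgap A c hc hAc r hr hopt.2.1
    rw [criterion, criterion] at h1
    constructor <;> linarith
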